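/- Let $p$ be a prime and let $(V,(p),k)$ be a complete unramified discrete valuation ring of mixed characteristic $(0,p)$ with perfect residue field $k=V/pV$. Let $A$ be a $\delta$-ring with Frobenius lift $\phi(x)=x^p+p\,\delta(x)$, let $I\subseteq A$ be a $\phi$-stable ideal (the ideal generated by $\phi(I)$ lies in $I$), put $R=A/I$, and let $\phi_R$ be the endomorphism of $R$ induced by $\phi$. Assume that $R$ is a Noetherian local $V$-algebra, with $V\to R$ local and inducing an isomorphism of residue fields, that $R$ is $p$-torsion free, and that $R/pR$ is reduced. Let $R_i=\operatorname{colim}\{R\xrightarrow{\phi_R}R\to\cdots\xrightarrow{\phi_R}R\}$ ($i$ arrows), let $\tau_i:R_i\to R_{i+1}$ be the canonical map (the identity on each of the $i+1$ copies of $R$ defining $R_i$), and regard $R_i$ as a $V$-algebra through $V\to R=R_0\to R_i$. Let $V_i=V[p^{1/p^i}]$ and let $t_i':V_i\to V_{i+1}$ be the inclusion. A *perfectoid tower arising from* $(R,(f))$ is a tower of rings $(\{T_i\},\{t_i\})$ with $T_0=R$, $p\in (f)$, such that, writing $\overline{T_i}=T_i/fT_i$: the maps $\overline{t_i}:\overline{T_i}\to\overline{T_{i+1}}$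 are injective; the Frobenius of $\overline{T_{i+1}}$ has image in that of $\overline{t_i}$, hence factors as $\overline{t_i}\circ F_i$ with $F_i:\overline{T_{i+1}}\to\overline{T_i}$ (the Frobenius projection); every $F_i$ is surjective; $fT_i$ lies in the Jacobson radical of $T_i$; there is a principal ideal $I_1$ of $T_1$ with $I_1^p=fT_1$ and $\ker F_i=I_1\overline{T_{i+1}}$ for all $i$; $f$ kills the $f$-power torsion of $T_i$; and there are bijections from the $f$-power torsion of $T_{i+1}$ to that of $T_i$ compatible with $F_i$. Its *tilt* is the tower of the rings $T_i^{s.\flat}=\varprojlim\{\cdots\xrightarrow{F_{i+1}}\overline{T_{i+1}}\xrightarrow{F_i}\overline{T_i}\}$, with transition maps $t_i^{s.\flat}$ induced by the $\overline{t_j}$. Then the following hold. 1. The tower $(\{V_i\},\{t'_i\})$ is a perfectoid tower arising from $(V,(p))$, and the tower $(\{S_i\},\{s_i\})=(\{R_i\otimes_V V_i\},\{\tau_i\otimes_V t_i'\})$ is a perfectoid tower arising from $(R,(p))$, where $R$ is identified with $S_0=R_0\otimes_V V_0$ by $r\mapsto r\otimes 1$. 2. The tilt of $(\{S_i\},\{s_i\})$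 is isomorphic, as a tower of rings, to $$\overline{R_0}\,\widehat{\otimes}_{k}\,V_0^{s.\flat}\longrightarrow\overline{R_1}\,\widehat{\otimes}_{k}\,V_1^{s.\flat}\longrightarrow\overline{R_2}\,\widehat{\otimes}_{k}\,V_2^{s.\flat}\longrightarrow\cdots$$ with transition maps induced by $\overline{\tau_i}\otimes (t'_i)^{s.\flat}$. Here $\overline{R_i}=R_i/pR_i$ is a $k$-algebra via $V\to R_i$; $V_i^{s.\flat}$ is the $k$-algebra given by the unique ring map $k\to V_i^{s.\flat}$ lifting $k\to V_i/pV_i$ along the $0$-th projection, namely $x\mapsto(x^{1/p^j})_{j\ge0}$; and $\overline{R_i}\,\widehat{\otimes}_k V_i^{s.\flat}$ is the completion of $\overline{R_i}\otimes_k V_i^{s.\flat}$ along the ideal generated by the kernel of the $0$-th projection $V_i^{s.\flat}\to V_i/pV_i$. -/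

import Mathlib

/-! Perfectoid towers, their tilts, and the towers built from Frobenius lifts. -/

noncomputable section

namespace PerfdTower

universe u v w

open scoped TensorProduct

/-! ### Towers of rings and of algebras -/

/-- A tower of rings `R₀ → R₁ → R₂ → ⋯`. -/
structure RingTower where
  obj : ℕ → Type u
  [commRing : ∀ i, CommRing (obj i)]
  map : ∀ i, obj i →+* obj (i + 1)

attribute [instance] RingTower.commRing

/-- A tower of algebras over a base ring `k`. -/
structure AlgTower (k : Type v) [CommRing k] where
  obj : ℕ → Type u
  [commRing : ∀ i, CommRing (obj i)]
  [algebra : ∀ i, Algebra k (obj i)]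
  map : ∀ i, obj i →ₐ[k] obj (i + 1)

attribute [instance] AlgTower.commRing AlgTower.algebra

/-- The underlying tower of rings of a tower of algebras. -/
abbrev AlgTower.toRingTower {k : Type v} [CommRing k] (T : AlgTower.{u} k) : RingTower.{u} where
  obj := T.obj
  map i := (T.map i).toRingHom

/-- The tensor product over `k` of two towers of `k`-algebras. -/
def AlgTower.tensor {k : Type v} [CommRing k] (T : AlgTower.{u} k) (U : AlgTower.{w} k) :
    AlgTower.{max u w} k where
  obj i := T.obj i ⊗[k] U.obj i
  map i := Algebra.TensorProduct.map (T.map i) (U.map i)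

namespace RingTower

/-- Isomorphism of towers of rings. -/
def IsIsomorphic (T : RingTower.{u}) (U : RingTower.{v}) : Prop :=
  ∃ e : ∀ i, T.obj i ≃+* U.obj i, ∀ i x, e (i + 1) (T.map i x) = U.map i (e i x)

variable (T : RingTower.{u})

/-- The composite `R₀ → Rᵢ`. -/
def fromZero : ∀ i, T.obj 0 →+* T.obj i
  | 0 => RingHom.id _
  | i + 1 => (T.map i).comp (fromZero i)

/-- The composite `R₁ → Rᵢ₊₁`. -/
def fromOne : ∀ i, T.obj 1 →+* T.obj (i + 1)
  | 0 => RingHom.id _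
  | i + 1 => (T.map (i + 1)).comp (fromOne i)

variable (I : Ideal (T.obj 0))

/-- The extended ideal `I Rᵢ`. -/
def levelIdeal (i : ℕ) : Ideal (T.obj i) := I.map (T.fromZero i)

/-- The reduction `Rᵢ / I Rᵢ`. -/
abbrev Red (i : ℕ) : Type u := T.obj i ⧸ T.levelIdeal I i

theorem levelIdeal_le_comap (i : ℕ) :
    T.levelIdeal I i ≤ (T.levelIdeal I (i + 1)).comap (T.map i) := by
  rw [← Ideal.map_le_iff_le_comap, levelIdeal, Ideal.map_map]
  exact le_rfl

/-- The induced map `Rᵢ / I Rᵢ → Rᵢ₊₁ / I Rᵢ₊₁`. -/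
def redMap (i : ℕ) : T.Red I i →+* T.Red I (i + 1) :=
  Ideal.quotientMap _ (T.map i) (T.levelIdeal_le_comap I i)

/-- The map `redMap i`, with target index any `j` equal to `i + 1`. -/
def redMapOfEq {i j : ℕ} (h : j = i + 1) : T.Red I i →+* T.Red I j :=
  match j, h with
  | _, rfl => T.redMap I i

/-- The `I`-torsion elements of `Rᵢ`: those killed by a power of each element of `I Rᵢ`. -/
def torsion (i : ℕ) : Set (T.obj i) :=
  {x | ∀ f ∈ T.levelIdeal I i, ∃ n : ℕ, f ^ n * x = 0}

end RingTower

/-! ### Purely inseparable towers and Frobenius projections -/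

/-- `T` is a `p`-purely inseparable tower arising from `(R₀, I)`, where `R₀` is its `0`-th layer. -/
structure IsPurelyInseparable (p : ℕ) (T : RingTower.{u}) (I : Ideal (T.obj 0)) : Prop where
  mem : (p : T.obj 0) ∈ I
  redMap_injective : ∀ i, Function.Injective (T.redMap I i)
  frobenius_mem_range : ∀ i (x : T.Red I (i + 1)), ∃ y, T.redMap I i y = x ^ p

/-- The Frobenius endomorphism of a ring in which `p = 0` (possibly the zero ring). -/
def frobHom (p : ℕ) [Fact p.Prime] (S : Type u) [CommRing S] (h : (p : S) = 0) : S →+* S where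
  toFun x := x ^ p
  map_zero' := zero_pow (Fact.out : p.Prime).ne_zero
  map_one' := one_pow p
  map_mul' x y := mul_pow x y p
  map_add' x y := by
    rcases subsingleton_or_nontrivial S with hS | hS
    · exact Subsingleton.elim _ _
    · have : CharP S p := (CharP.charP_iff_prime_eq_zero Fact.out).2 h
      exact add_pow_char x y p

namespace IsPurelyInseparable

variable {p : ℕ} {T : RingTower.{u}} {I : Ideal (T.obj 0)}

theorem natCast_red_eq_zero (h : IsPurelyInseparable p T I) (i : ℕ) :
    (p : T.Red I i) = 0 := by
  have h1 : T.fromZero i (p : T.obj 0) ∈ T.levelIdeal I i := Ideal.mem_map_of_mem _ h.mem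
  rw [map_natCast] at h1
  rw [← map_natCast (Ideal.Quotient.mk (T.levelIdeal I i)) p]
  exact Ideal.Quotient.eq_zero_iff_mem.2 h1

variable [Fact p.Prime]

/-- The `i`-th Frobenius projection `Fᵢ : Rᵢ₊₁ / I Rᵢ₊₁ → Rᵢ / I Rᵢ`: the Frobenius endomorphism of
`Rᵢ₊₁ / I Rᵢ₊₁`, which takes values in the image of the injection `redMap i`, followed by the
inverse of that injection on its image. -/
def frobProj (h : IsPurelyInseparable p T I) (i : ℕ) : T.Red I (i + 1) →+* T.Red I i :=
  (RingEquiv.ofBijective (T.redMap I i).rangeRestrict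
    ⟨fun _ _ hxy => h.redMap_injective i (congrArg Subtype.val hxy),
      (T.redMap I i).rangeRestrict_surjective⟩).symm.toRingHom.comp
    ((frobHom p (T.Red I (i + 1)) (h.natCast_red_eq_zero (i + 1))).codRestrict
      (T.redMap I i).range (fun x => h.frobenius_mem_range i x))

theorem redMap_frobProj (h : IsPurelyInseparable p T I) (i : ℕ) (x : T.Red I (i + 1)) :
    T.redMap I i (h.frobProj i x) = x ^ p := by
  have := congrArg Subtype.val (RingEquiv.apply_symm_apply
    (RingEquiv.ofBijective (T.redMap I i).rangeRestrict
    ⟨fun _ _ hxy => h.redMap_injective i (congrArg Subtype.val hxy),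
      (T.redMap I i).rangeRestrict_surjective⟩)
    ((frobHom p (T.Red I (i + 1)) (h.natCast_red_eq_zero (i + 1))).codRestrict
      (T.redMap I i).range (fun x => h.frobenius_mem_range i x) x))
  exact this

theorem frobProj_redMapOfEq (h : IsPurelyInseparable p T I) {n m : ℕ} (hm : m = n + 1)
    (x : T.Red I (n + 1)) :
    h.frobProj m (T.redMapOfEq I (congrArg (· + 1) hm) x) =
      T.redMapOfEq I hm (h.frobProj n x) := by
  subst hm
  apply h.redMap_injective (n + 1)
  change T.redMap I (n + 1) (h.frobProj (n + 1) (T.redMap I (n + 1) x)) =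
    T.redMap I (n + 1) (T.redMap I n (h.frobProj n x))
  rw [h.redMap_frobProj, h.redMap_frobProj, map_pow]

/-! ### The tilt -/

/-- The `i`-th small tilt, the inverse limit of
`⋯ → Rᵢ₊₂ / I Rᵢ₊₂ → Rᵢ₊₁ / I Rᵢ₊₁ → Rᵢ / I Rᵢ` along the Frobenius projections. The `j`-th
coordinate of an element lies in `Rᵢ₊ⱼ / I Rᵢ₊ⱼ`. -/
def smallTilt (h : IsPurelyInseparable p T I) (i : ℕ) : Subring (∀ j, T.Red I (i + j)) where
  carrier := {a | ∀ j, h.frobProj (i + j) (a (j + 1)) = a j}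
  mul_mem' ha hb j := (map_mul _ _ _).trans (congrArg₂ (· * ·) (ha j) (hb j))
  one_mem' _ := map_one _
  add_mem' ha hb j := (map_add _ _ _).trans (congrArg₂ (· + ·) (ha j) (hb j))
  zero_mem' _ := map_zero _
  neg_mem' ha j := (map_neg _ _).trans (congrArg (- ·) (ha j))

/-- The transition map of the tilt, applying `Rₙ / I Rₙ → Rₙ₊₁ / I Rₙ₊₁` in each coordinate. -/
def tiltMap (h : IsPurelyInseparable p T I) (i : ℕ) : h.smallTilt i →+* h.smallTilt (i + 1) :=
  RingHom.codRestrict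
    ((RingHom.pi fun j => (T.redMapOfEq I (Nat.add_right_comm i 1 j)).comp
      (Pi.evalRingHom _ j)).comp (h.smallTilt i).subtype)
    (h.smallTilt (i + 1))
    (fun a j => (h.frobProj_redMapOfEq (Nat.add_right_comm i 1 j) (a.1 (j + 1))).trans
      (congrArg _ (a.2 j)))

/-- The tilt of a tower: the tower of its small tilts. -/
def tilt (h : IsPurelyInseparable p T I) : RingTower.{u} where
  obj i := h.smallTilt i
  map := h.tiltMap

/-- The `0`-th projection from the `i`-th small tilt to `Rᵢ / I Rᵢ`. -/
def projZero (h : IsPurelyInseparable p T I) (i : ℕ) : h.smallTilt i →+* T.Red I i :=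
  (Pi.evalRingHom (fun j => T.Red I (i + j)) 0).comp (h.smallTilt i).subtype

theorem projZero_tiltMap (h : IsPurelyInseparable p T I) (i : ℕ) (a : h.smallTilt i) :
    h.projZero (i + 1) (h.tiltMap i a) = T.redMap I i (h.projZero i a) := rfl

theorem map_ker_projZero_le (h : IsPurelyInseparable p T I) (i : ℕ) :
    (RingHom.ker (h.projZero i)).map (h.tiltMap i) ≤ RingHom.ker (h.projZero (i + 1)) := by
  rw [Ideal.map_le_iff_le_comap]
  intro a ha
  rw [RingHom.mem_ker] at ha
  rw [Ideal.mem_comap, RingHom.mem_ker, projZero_tiltMap, ha, map_zero]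

end IsPurelyInseparable

/-! ### Perfectoid towers -/

/-- `T` is a perfectoid tower arising from `(R₀, I)`, where `R₀` is its `0`-th layer. -/
structure IsPerfectoidTower (p : ℕ) [Fact p.Prime] (T : RingTower.{u}) (I : Ideal (T.obj 0)) :
    Prop extends IsPurelyInseparable p T I where
  frobProj_surjective : ∀ i, Function.Surjective (toIsPurelyInseparable.frobProj i)
  zariskian : ∀ i, T.levelIdeal I i ≤ Ring.jacobson (T.obj i)
  principal : I.IsPrincipal
  pillar : ∃ I₁ : Ideal (T.obj 1), I₁.IsPrincipal ∧ I₁ ^ p = T.levelIdeal I 1 ∧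
    ∀ i, RingHom.ker (toIsPurelyInseparable.frobProj i) =
      (I₁.map (T.fromOne i)).map (Ideal.Quotient.mk (T.levelIdeal I (i + 1)))
  mul_torsion : ∀ i, ∀ f ∈ T.levelIdeal I i, ∀ x ∈ T.torsion I i, f * x = 0
  exists_torsion_bijection : ∀ i, ∃ g : T.torsion I (i + 1) → T.torsion I i,
    Function.Bijective g ∧ ∀ x : T.torsion I (i + 1),
      Ideal.Quotient.mk (T.levelIdeal I i) (g x) =
        toIsPurelyInseparable.frobProj i (Ideal.Quotient.mk (T.levelIdeal I (i + 1)) x)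

/-- `T` is a perfectoid tower arising from `(R, I)`, where `R` is identified with the `0`-th layer
of `T` through `ι`. -/
structure IsPerfectoidTowerFrom (p : ℕ) [Fact p.Prime] (T : RingTower.{u}) {R : Type v}
    [CommRing R] (ι : R →+* T.obj 0) (I : Ideal R) : Prop where
  bijective : Function.Bijective ι
  isPerfectoidTower : IsPerfectoidTower p T (I.map ι)

namespace IsPerfectoidTowerFrom

variable {p : ℕ} [Fact p.Prime] {T : RingTower.{u}} {R : Type v} [CommRing R]
  {ι : R →+* T.obj 0} {I : Ideal R}

theorem isPurelyInseparable (h : IsPerfectoidTowerFrom p T ι I) :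
    IsPurelyInseparable p T (I.map ι) :=
  h.isPerfectoidTower.toIsPurelyInseparable

/-- The tilt of a perfectoid tower arising from `(R, I)`. -/
def tilt (h : IsPerfectoidTowerFrom p T ι I) : RingTower.{u} := h.isPurelyInseparable.tilt

end IsPerfectoidTowerFrom

/-! ### Reductions and tilts of towers of algebras, as towers of algebras over the reduced base -/

namespace AlgTower

variable {V : Type v} [CommRing V] (T : AlgTower.{u} V) (a : Ideal V)

theorem fromZero_algebraMap (i : ℕ) (x : V) :
    T.toRingTower.fromZero i (algebraMap V (T.obj 0) x) = algebraMap V (T.obj i) x := by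
  induction i with
  | zero => rfl
  | succ i ih =>
    change T.map i (T.toRingTower.fromZero i (algebraMap V (T.obj 0) x)) = _
    rw [ih, AlgHom.commutes]

/-- The ideal of the `0`-th layer generated by an ideal of the base ring. -/
abbrev baseIdeal : Ideal (T.toRingTower.obj 0) := a.map (algebraMap V (T.obj 0))

/-- The structure map `V / a → Tᵢ / a Tᵢ`. -/
def redStructure (i : ℕ) : V ⧸ a →+* T.toRingTower.Red (T.baseIdeal a) i :=
  Ideal.quotientMap _ (algebraMap V (T.obj i)) (by
    intro x hx
    rw [Ideal.mem_comap, ← T.fromZero_algebraMap i x]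
    exact Ideal.mem_map_of_mem _ (Ideal.mem_map_of_mem _ hx))

theorem redMap_redStructure (i : ℕ) (x : V ⧸ a) :
    T.toRingTower.redMap (T.baseIdeal a) i (T.redStructure a i x) =
      T.redStructure a (i + 1) x := by
  obtain ⟨x, rfl⟩ := Ideal.Quotient.mk_surjective x
  change Ideal.Quotient.mk _ (T.map i (algebraMap V (T.obj i) x)) =
    Ideal.Quotient.mk _ (algebraMap V (T.obj (i + 1)) x)
  rw [AlgHom.commutes]

theorem redMapOfEq_redStructure {i j : ℕ} (h : j = i + 1) (x : V ⧸ a) :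
    T.toRingTower.redMapOfEq (T.baseIdeal a) h (T.redStructure a i x) =
      T.redStructure a j x := by
  subst h
  exact T.redMap_redStructure a i x

/-- The tower of `V / a`-algebras `T₀ / a T₀ → T₁ / a T₁ → ⋯`. -/
def reduction : AlgTower.{u} (V ⧸ a) :=
  letI (i : ℕ) : Algebra (V ⧸ a) (T.toRingTower.Red (T.baseIdeal a) i) :=
    (T.redStructure a i).toAlgebra
  { obj := fun i => T.toRingTower.Red (T.baseIdeal a) i
    map := fun i =>
      { T.toRingTower.redMap (T.baseIdeal a) i with
        commutes' := T.redMap_redStructure a i } }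

variable {T a} {p : ℕ} [Fact p.Prime] [CharP (V ⧸ a) p] [PerfectRing (V ⧸ a) p]

/-- If `V / a` is perfect, the `i`-th small tilt is a `V / a`-algebra: `x` acts in the `j`-th
coordinate as `x ^ (1 / p ^ j)`. It is the unique structure for which the `0`-th projection to
`Tᵢ / a Tᵢ` is a map of `V / a`-algebras. -/
def tiltStructure (h : IsPurelyInseparable p T.toRingTower (T.baseIdeal a)) (i : ℕ) :
    V ⧸ a →+* h.smallTilt i :=
  RingHom.codRestrict
    (RingHom.pi fun j => (T.redStructure a (i + j)).comp
      (iterateFrobeniusEquiv (V ⧸ a) p j).symm.toRingHom)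
    (h.smallTilt i)
    (fun x j => by
      apply h.redMap_injective (i + j)
      rw [h.redMap_frobProj]
      change T.redStructure a (i + j + 1) ((iterateFrobeniusEquiv (V ⧸ a) p (j + 1)).symm x) ^ p =
        T.toRingTower.redMap _ (i + j)
          (T.redStructure a (i + j) ((iterateFrobeniusEquiv (V ⧸ a) p j).symm x))
      rw [T.redMap_redStructure, ← map_pow]
      congr 1
      apply (iterateFrobeniusEquiv (V ⧸ a) p j).injective
      rw [RingEquiv.apply_symm_apply, iterateFrobeniusEquiv_apply, iterateFrobenius_def,
        ← pow_mul, ← pow_succ', ← iterateFrobenius_def, ← iterateFrobeniusEquiv_apply,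
        RingEquiv.apply_symm_apply])

/-- The tilt, as a tower of `V / a`-algebras. -/
def tilt (h : IsPurelyInseparable p T.toRingTower (T.baseIdeal a)) : AlgTower.{u} (V ⧸ a) :=
  letI (i : ℕ) : Algebra (V ⧸ a) (h.smallTilt i) := (tiltStructure h i).toAlgebra
  { obj := fun i => h.smallTilt i
    map := fun i =>
      { h.tiltMap i with
        commutes' := fun _ => Subtype.ext (funext fun _ =>
          (T.redMapOfEq_redStructure a _ _)) } }

end AlgTower

/-! ### Completed tensor products -/

/-- The map on adic completions induced by a ring map carrying `I` into `J`. -/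
def adicCompletionMap {A : Type u} {B : Type v} [CommRing A] [CommRing B] (f : A →+* B)
    (I : Ideal A) (J : Ideal B) (h : I.map f ≤ J) : AdicCompletion I A →+* AdicCompletion J B :=
  AdicCompletion.liftRingHom J
    (fun n => (Ideal.quotientMap (J ^ n) f (I := I ^ n) (by
      rw [← Ideal.map_le_iff_le_comap, Ideal.map_pow]
      exact Ideal.pow_right_mono h n)).comp (AdicCompletion.evalₐ I n).toRingHom)
    (by
      intro m n hle
      ext x
      obtain ⟨y, rfl⟩ := AdicCompletion.mk_surjective I A x
      have hm := (AdicCompletion.evalₐ_mk I m y).trans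
        (AdicCompletion.Ideal.mk_eq_mk I hle y).symm
      simp only [RingHom.comp_apply, AlgHom.toRingHom_eq_coe, RingHom.coe_coe, hm,
        AdicCompletion.evalₐ_mk, Ideal.quotientMap_mk]
      rfl)

/-- The completed tensor product of two towers of `k`-algebras: the `i`-th layer is the completion
of `Pᵢ ⊗ Qᵢ` along the ideal generated by the ideal `Jᵢ` of `Qᵢ`. -/
def AlgTower.completedTensor {k : Type v} [CommRing k] (P : AlgTower.{u} k) (Q : AlgTower.{w} k)
    (J : ∀ i, Ideal (Q.obj i)) (hJ : ∀ i, (J i).map (Q.map i) ≤ J (i + 1)) :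
    RingTower.{max u w} where
  obj i := AdicCompletion
    ((J i).map (Algebra.TensorProduct.includeRight : Q.obj i →ₐ[k] P.obj i ⊗[k] Q.obj i))
    (P.obj i ⊗[k] Q.obj i)
  map i := adicCompletionMap
    (Algebra.TensorProduct.map (P.map i) (Q.map i)).toRingHom _ _ (by
      rw [Ideal.map_le_iff_le_comap, Ideal.map_le_iff_le_comap]
      intro x hx
      have h := Ideal.mem_map_of_mem
        (Algebra.TensorProduct.includeRight : Q.obj (i + 1) →ₐ[k] P.obj (i + 1) ⊗[k] Q.obj (i + 1))
        (hJ i (Ideal.mem_map_of_mem (Q.map i) hx))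
      rw [Ideal.mem_comap, Ideal.mem_comap]
      simpa using h)

/-! ### Frobenius lifts -/

/-- A `δ`-structure (`p`-derivation) on `A`. In the sum formula, the sum over `0 < k < p` is the
integral polynomial `((x + y) ^ p - x ^ p - y ^ p) / p`. -/
structure PDerivation (p : ℕ) (A : Type u) [CommRing A] where
  toFun : A → A
  map_zero : toFun 0 = 0
  map_one : toFun 1 = 0
  map_mul : ∀ x y, toFun (x * y) = x ^ p * toFun y + y ^ p * toFun x + p * toFun x * toFun y
  map_add : ∀ x y, toFun (x + y) = toFun x + toFun y -
    ∑ k ∈ Finset.Ioo 0 p, x ^ k * y ^ (p - k) * ((p.choose k / p : ℕ) : A)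

/-- The Frobenius lift `φ(x) = x ^ p + p δ(x)` of a `δ`-ring. -/
def PDerivation.phi {p : ℕ} [Fact p.Prime] {A : Type u} [CommRing A] (δ : PDerivation p A) :
    A →+* A where
  toFun x := x ^ p + p * δ.toFun x
  map_zero' := by simp [δ.map_zero, (Fact.out : p.Prime).ne_zero]
  map_one' := by simp [δ.map_one]
  map_mul' x y := by rw [δ.map_mul]; ring
  map_add' x y := by
    rw [δ.map_add, add_pow_prime_eq' Fact.out x y]
    generalize ∑ k ∈ Finset.Ioo 0 p, x ^ k * y ^ (p - k) * ((p.choose k / p : ℕ) : A) = s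
    ring

/-- An ideal is `φ`-stable if the ideal generated by `φ(a)`, for `a ∈ I`, is contained in `I`. -/
def IsPhiStable {A : Type u} [CommRing A] (φ : A →+* A) (I : Ideal A) : Prop := I.map φ ≤ I

/-- The endomorphism of `A / I` induced by `φ`. -/
def IsPhiStable.quotientMap {A : Type u} [CommRing A] {φ : A →+* A} {I : Ideal A}
    (h : IsPhiStable φ I) : A ⧸ I →+* A ⧸ I :=
  Ideal.quotientMap I φ (Ideal.map_le_iff_le_comap.1 h)

section PhiTower

variable {R : Type u} [CommRing R] (φ : R →+* R)

/-- The finite colimit of `R → R → ⋯ → R`, with `i` arrows, all equal to `φ`. -/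
abbrev FiniteColim (i : ℕ) : Type u :=
  Ring.DirectLimit (fun _ : Fin (i + 1) => R) (fun a b _ => ⇑(φ ^ ((b : ℕ) - (a : ℕ))))

/-- The map of the `j`-th copy of `R` to the colimit. -/
abbrev FiniteColim.of (i : ℕ) (j : Fin (i + 1)) : R →+* FiniteColim φ i :=
  Ring.DirectLimit.of (fun _ : Fin (i + 1) => R) (fun a b _ => ⇑(φ ^ ((b : ℕ) - (a : ℕ)))) j

/-- The transition map of colimits which is the identity on the `j`-th copy of `R`, `j ≤ i`. -/
def FiniteColim.transition (i : ℕ) : FiniteColim φ i →+* FiniteColim φ (i + 1) :=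
  Ring.DirectLimit.lift _ _ _ (fun j => FiniteColim.of φ (i + 1) j.castSucc) (fun a b hab x =>
    Ring.DirectLimit.of_f (G := fun _ : Fin (i + 1 + 1) => R)
      (f := fun a b _ => ⇑(φ ^ ((b : ℕ) - (a : ℕ)))) (i := a.castSucc) (j := b.castSucc) hab x)

/-- For a `V`-algebra `R`, the tower `R = R₀ → R₁ → ⋯` of the finite colimits of `φ`. Each `Rᵢ` is
an algebra over `V` through `V → R = R₀ → Rᵢ`. -/
def phiTower (V : Type v) [CommRing V] [Algebra V R] : AlgTower.{u} V :=
  letI (i : ℕ) : Algebra V (FiniteColim φ i) :=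
    ((FiniteColim.of φ i 0).comp (algebraMap V R)).toAlgebra
  { obj := FiniteColim φ
    map := fun i =>
      { FiniteColim.transition φ i with
        commutes' := fun _ => Ring.DirectLimit.lift_of _ _ _ _ _ } }

end PhiTower

/-! ### Adjoining the `p`-power roots of `p` -/

open Polynomial in
/-- `V[p ^ (1 / p ^ i)]`, as `V[X] / (X ^ (p ^ i) - p)`. -/
abbrev AdjoinPRoot (V : Type v) [CommRing V] (p i : ℕ) : Type v :=
  AdjoinRoot (X ^ p ^ i - C (p : V) : V[X])

/-- The tower `V → V[p ^ (1 / p)] → V[p ^ (1 / p ^ 2)] → ⋯`. The transition maps are the inclusions,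
sending `p ^ (1 / p ^ i)` to the `p`-th power of `p ^ (1 / p ^ (i + 1))`. -/
def rootTower (V : Type v) [CommRing V] (p : ℕ) : AlgTower.{v} V where
  obj := AdjoinPRoot V p
  map i := AdjoinRoot.liftAlgHom _ (Algebra.ofId V _) (AdjoinRoot.root _ ^ p) (by
    have h := AdjoinRoot.eval₂_root (Polynomial.X ^ p ^ (i + 1) - Polynomial.C (p : V))
    simp only [Polynomial.eval₂_sub, Polynomial.eval₂_pow, Polynomial.eval₂_X,
      Polynomial.eval₂_C] at h ⊢
    rw [← pow_mul, ← pow_succ']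
    exact h)

/-! ### The tower `Sᵢ = Rᵢ ⊗ Vᵢ` -/

/-- The tower `Sᵢ = Rᵢ ⊗ V[p ^ (1 / p ^ i)]` of an endomorphism `φ` of a `V`-algebra `R`. -/
abbrev sTower (V : Type v) [CommRing V] (p : ℕ) {R : Type u} [CommRing R] [Algebra V R]
    (φ : R →+* R) : AlgTower.{max u v} V :=
  (phiTower φ V).tensor (rootTower V p)

/-- The identification `R → S₀ = R₀ ⊗ V₀`, sending `r` to `r ⊗ 1`. -/
def toSTowerZero (V : Type v) [CommRing V] (p : ℕ) {R : Type u} [CommRing R] [Algebra V R]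
    (φ : R →+* R) : R →+* (sTower V p φ).toRingTower.obj 0 :=
  RingHom.comp (Algebra.TensorProduct.includeLeftRingHom :
    (phiTower φ V).obj 0 →+* (phiTower φ V).obj 0 ⊗[V] (rootTower V p).obj 0)
    (FiniteColim.of φ 0 0)

end PerfdTower

end

open PerfdTower

/-! Both towers consist of rings `B[p^(1/p^i)]`, whose transition maps send each root to the `p`-th
power of the next one and act on `B` through an endomorphism: the identity for `B = V`, and `φ` for
`B = R`, because `R_i` is just its last copy of `R`. Modulo `p` the equation of the root becomes
`X^(p^i) = 0`. With `K = B/p`, layer `i` is therefore `K⟦X⟧/(X^(p^i))`, and the transition map sends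
`X` to `X^p` and applies some `ψ` to coefficients.

Suppose that `ψ` is injective and that `ψ ∘ σ` is the Frobenius of `K` for an automorphism `σ`. Then
`f^p` is the image of `σ(f)`, so the Frobenius projection is `σ` on coefficients followed by
truncation. It is surjective with kernel generated by `X^(p^i)`, the image of `p^(1/p)`, and the
torsion axioms are empty when `B` is `p`-torsion free (`RootPresentation.isPerfectoidTower`). The
pair `(ψ, σ)` is (identity, Frobenius) for `V`, whose residue field is perfect, and (Frobenius,
identity) for `R`, since `φ` lifts Frobenius and `R/p` is reduced.

Untwisting by powers of `σ`, the inverse limit is `K⟦X⟧` (`toTilt_bijective`). On the other side,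
the completion of `P ⊗ k⟦X⟧` along a power of `X` is `P⟦X⟧` (`powerSeriesToCompletion_bijective`).
Both towers in the second claim thus have layers `(R/p)⟦X⟧`, with Frobenius on coefficients and `X ↦
X^p` as transition map. -/

noncomputable section

set_option linter.unusedSectionVars false

namespace PerfdTower

open PowerSeries
open scoped TensorProduct

/-! ### `X`-adic limits and divisibility in power series rings. -/

section PowerSeriesLimits

variable {K : Type*} [CommRing K]

/-- Power series which are compatible modulo increasing powers of `X` have a common limit. -/
theorem exists_powerSeries_limit {M : ℕ → ℕ} (hM : Monotone M) (hle : ∀ j, j ≤ M j)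
    (f : ℕ → K⟦X⟧) (hf : ∀ j, (X : K⟦X⟧) ^ M j ∣ f (j + 1) - f j) :
    ∃ g : K⟦X⟧, ∀ j, (X : K⟦X⟧) ^ M j ∣ g - f j := by
  have key : ∀ j j' d, j ≤ j' → d < M j → coeff d (f j') = coeff d (f j) := by
    intro j j' d hjj' hd
    induction j', hjj' using Nat.le_induction with
    | base => rfl
    | succ n hn ih =>
      have := X_pow_dvd_iff.1 (hf n) d (hd.trans_le (hM hn))
      rw [map_sub, sub_eq_zero] at this
      rw [this, ih]
  -- The `d`-th coefficient is stable from index `d + 1` on, because `d < d + 1 ≤ M (d + 1)`.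
  refine ⟨PowerSeries.mk fun d => coeff d (f (d + 1)), fun j => X_pow_dvd_iff.2 fun d hd => ?_⟩
  rw [map_sub, coeff_mk, sub_eq_zero]
  rcases le_total j (d + 1) with h | h
  · exact key _ _ _ h hd
  · exact (key _ _ _ h (hle (d + 1))).symm

theorem eq_zero_of_forall_X_pow_dvd {M : ℕ → ℕ} (hle : ∀ j, j ≤ M j) {g : K⟦X⟧}
    (hg : ∀ j, (X : K⟦X⟧) ^ M j ∣ g) : g = 0 := by
  ext d
  exact X_pow_dvd_iff.1 (hg (d + 1)) d (hle (d + 1))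

theorem X_pow_dvd_sub_trunc (n : ℕ) (f : K⟦X⟧) : (X : K⟦X⟧) ^ n ∣ f - (trunc n f : K⟦X⟧) :=
  X_pow_dvd_iff.2 fun d hd => by simp [coeff_trunc, hd]

theorem X_pow_dvd_map {L : Type*} [CommRing L] (u : K →+* L) {n : ℕ} {f : K⟦X⟧}
    (h : (X : K⟦X⟧) ^ n ∣ f) : (X : L⟦X⟧) ^ n ∣ PowerSeries.map u f := by
  simpa using map_dvd (PowerSeries.map u) h

theorem X_pow_dvd_expand {p : ℕ} (hp : p ≠ 0) {n : ℕ} {f : K⟦X⟧}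
    (h : (X : K⟦X⟧) ^ n ∣ f) : (X : K⟦X⟧) ^ (p * n) ∣ expand p hp f := by
  simpa [pow_mul] using map_dvd (expand p hp) h

end PowerSeriesLimits

/-! ### Maps into a quotient through a surjection with the same kernel. -/

section QuotientLift

variable {A B C : Type*} [CommRing A] [CommRing B] [CommRing C]

/-- The map `B → A / I` deduced from a map to `C` and a surjection `A → C` with kernel `I`. -/
def quotientLift (ρ : A →+* C) (hρ : Function.Surjective ρ) {I : Ideal A} (hI : RingHom.ker ρ = I)
    (q : B →+* C) : B →+* A ⧸ I :=
  ((Ideal.quotEquivOfEq hI.symm).trans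
    (RingHom.quotientKerEquivOfSurjective hρ)).symm.toRingHom.comp q

/-- This reduces every later computation with the inverted isomorphism to a choice of
representatives in `A`. -/
theorem quotientLift_eq_iff (ρ : A →+* C) (hρ : Function.Surjective ρ) {I : Ideal A}
    (hI : RingHom.ker ρ = I) (q : B →+* C) (b : B) (a : A) :
    quotientLift ρ hρ hI q b = Ideal.Quotient.mk I a ↔ q b = ρ a := by
  subst hI
  change ((Ideal.quotEquivOfEq _).trans
    (RingHom.quotientKerEquivOfSurjective hρ)).symm (q b) = _ ↔ _
  rw [RingEquiv.symm_apply_eq]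
  rfl

end QuotientLift

/-! ### The completion of `P ⊗ k⟦X⟧` is `P⟦X⟧`. -/

section CompletedTensor

variable {k P Q : Type*} [CommRing k] [CommRing P] [CommRing Q] [Algebra k P] [Algebra k Q]
  (α : k⟦X⟧ ≃ₐ[k] Q)

variable (P) in
/-- The map `P ⊗ k⟦X⟧ → P⟦X⟧`. -/
def tensorToPowerSeries : P ⊗[k] Q →ₐ[P] P⟦X⟧ :=
  Algebra.TensorProduct.lift (Algebra.ofId P P⟦X⟧)
    ((PowerSeries.mapAlgHom (Algebra.ofId k P)).comp (α.symm : Q →ₐ[k] k⟦X⟧))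
    (fun _ _ => Commute.all _ _)

theorem tensorToPowerSeries_tmul (r : P) (f : k⟦X⟧) :
    tensorToPowerSeries P α (r ⊗ₜ α f) = C r * PowerSeries.map (algebraMap k P) f := by
  rw [tensorToPowerSeries, Algebra.TensorProduct.lift_tmul]
  simp [Algebra.ofId_apply]
  rfl

/-- Modulo `X ^ M` only finitely many coefficients matter, and these can be moved across the tensor
sign. This is why `P ⊗ k⟦X⟧` and `P⟦X⟧` agree modulo each power of `X`, although they may differ
before completion. -/
theorem exists_tensor_truncation (M : ℕ) (a : P ⊗[k] Q) :
    ∃ (s : ℕ → P) (a' : P ⊗[k] Q),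
      a = ∑ m ∈ Finset.range M, s m ⊗ₜ α (X ^ m) + (1 ⊗ₜ α (X ^ M)) * a' := by
  induction a with
  | zero => exact ⟨0, 0, by simp⟩
  | add a b ha hb =>
    obtain ⟨s, a', rfl⟩ := ha
    obtain ⟨t, b', rfl⟩ := hb
    refine ⟨s + t, a' + b', ?_⟩
    simp only [Pi.add_apply, TensorProduct.add_tmul, Finset.sum_add_distrib]
    ring
  | tmul r q =>
    obtain ⟨f, rfl⟩ := α.surjective q
    obtain ⟨g, hg⟩ := X_pow_dvd_sub_trunc M f
    refine ⟨fun m => coeff m f • r, r ⊗ₜ α g, ?_⟩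
    have h1 : f = ∑ m ∈ Finset.range M, coeff m f • (X : k⟦X⟧) ^ m + X ^ M * g := by
      rw [← hg]
      ext d
      simp [PowerSeries.coeff_X_pow, coeff_trunc]
    conv_lhs => rw [h1]
    rw [map_add, map_sum, TensorProduct.tmul_add, TensorProduct.tmul_sum, map_mul,
      Algebra.TensorProduct.tmul_mul_tmul, one_mul]
    simp only [map_smul, TensorProduct.smul_tmul]

theorem tensorToPowerSeries_truncation (M : ℕ) (s : ℕ → P) (a' : P ⊗[k] Q) (d : ℕ) (hd : d < M) :
    coeff d (tensorToPowerSeries P α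
      (∑ m ∈ Finset.range M, s m ⊗ₜ α (X ^ m) + (1 ⊗ₜ α (X ^ M)) * a')) = s d := by
  rw [map_add, map_sum, map_mul]
  simp only [tensorToPowerSeries_tmul]
  simp only [map_pow, PowerSeries.map_X, map_one, one_mul]
  rw [map_add, X_pow_dvd_iff.1 (Dvd.intro _ rfl) d hd, add_zero]
  simp [PowerSeries.coeff_X_pow, hd]

/-- The coefficients of a truncation can be read off from its image, so if they vanish there the
tensor itself is a multiple of `X ^ M`. Injectivity of `P ⊗ k⟦X⟧ → P⟦X⟧` is not needed. -/
theorem X_pow_dvd_tensorToPowerSeries_iff (M : ℕ) (a : P ⊗[k] Q) :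
    (X : P⟦X⟧) ^ M ∣ tensorToPowerSeries P α a ↔ (1 : P) ⊗ₜ[k] α (X ^ M) ∣ a := by
  constructor
  · intro h
    obtain ⟨s, a', ha⟩ := exists_tensor_truncation α M a
    refine ⟨a', ?_⟩
    have hs : ∑ m ∈ Finset.range M, s m ⊗ₜ[k] α (X ^ m) = 0 := by
      refine Finset.sum_eq_zero fun m hm => ?_
      have hm := Finset.mem_range.1 hm
      have := X_pow_dvd_iff.1 h m hm
      rw [ha, tensorToPowerSeries_truncation α M s a' m hm] at this
      rw [this, TensorProduct.zero_tmul]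
    rwa [hs, zero_add] at ha
  · rintro ⟨a', rfl⟩
    rw [map_mul, tensorToPowerSeries_tmul]
    simp

theorem exists_X_pow_dvd_sub_tensorToPowerSeries (M : ℕ) (g : P⟦X⟧) :
    ∃ a : P ⊗[k] Q, (X : P⟦X⟧) ^ M ∣ g - tensorToPowerSeries P α a := by
  -- The summand `* 0` gives the witness the shape required by `tensorToPowerSeries_truncation`.
  refine ⟨∑ m ∈ Finset.range M, coeff m g ⊗ₜ α (X ^ m) + (1 ⊗ₜ α (X ^ M)) * 0,
    X_pow_dvd_iff.2 fun d hd => ?_⟩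
  rw [map_sub, tensorToPowerSeries_truncation α M _ _ d hd, sub_self]

variable {N : ℕ} {J : Ideal Q} (hJ : J = Ideal.span {α (X ^ N)})

variable (P) in
/-- The ideal of `P ⊗ Q` generated by an ideal of `Q`. -/
abbrev tensorIdeal (J : Ideal Q) : Ideal (P ⊗[k] Q) :=
  J.map (Algebra.TensorProduct.includeRight : Q →ₐ[k] P ⊗[k] Q)

include hJ in
theorem tensorIdeal_pow (n : ℕ) :
    tensorIdeal (k := k) P J ^ n = Ideal.span {(1 : P) ⊗ₜ[k] α (X ^ (N * n))} := by
  rw [tensorIdeal, hJ, Ideal.map_span, Set.image_singleton, Ideal.span_singleton_pow]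
  simp [pow_mul]

variable (P) in
include hJ in
theorem ker_tensorToQuotient (n : ℕ) :
    RingHom.ker ((Ideal.Quotient.mk (Ideal.span {(X : P⟦X⟧) ^ (N * n)})).comp
      (tensorToPowerSeries P α).toRingHom) = tensorIdeal (k := k) P J ^ n := by
  ext a
  rw [tensorIdeal_pow α hJ, RingHom.mem_ker, Ideal.mem_span_singleton, RingHom.comp_apply,
    Ideal.Quotient.eq_zero_iff_mem, Ideal.mem_span_singleton]
  exact X_pow_dvd_tensorToPowerSeries_iff α (N * n) a

variable (P) in
theorem tensorToQuotient_surjective (n : ℕ) :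
    Function.Surjective ((Ideal.Quotient.mk (Ideal.span {(X : P⟦X⟧) ^ (N * n)})).comp
      (tensorToPowerSeries P α).toRingHom) := by
  intro y
  obtain ⟨g, rfl⟩ := Ideal.Quotient.mk_surjective y
  obtain ⟨a, ha⟩ := exists_X_pow_dvd_sub_tensorToPowerSeries α (N * n) g
  exact ⟨a, (Ideal.Quotient.eq.2 (Ideal.mem_span_singleton.2 ha)).symm⟩

variable (P) in
/-- The map `P⟦X⟧ → (P ⊗ Q) / (J) ^ n`. -/
def powerSeriesToQuotient (n : ℕ) : P⟦X⟧ →+* (P ⊗[k] Q) ⧸ tensorIdeal (k := k) P J ^ n :=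
  quotientLift _ (tensorToQuotient_surjective P α n) (ker_tensorToQuotient P α hJ n)
    (Ideal.Quotient.mk (Ideal.span {(X : P⟦X⟧) ^ (N * n)}))

theorem powerSeriesToQuotient_eq_iff (n : ℕ) (g : P⟦X⟧) (a : P ⊗[k] Q) :
    powerSeriesToQuotient P α hJ n g = Ideal.Quotient.mk _ a ↔
      (X : P⟦X⟧) ^ (N * n) ∣ g - tensorToPowerSeries P α a := by
  rw [powerSeriesToQuotient, quotientLift_eq_iff, RingHom.comp_apply, Ideal.Quotient.eq,
    Ideal.mem_span_singleton]
  rfl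

variable (P) in
theorem factorPow_powerSeriesToQuotient {m n : ℕ} (hle : m ≤ n) :
    (Ideal.Quotient.factorPow (tensorIdeal (k := k) P J) hle).comp
      (powerSeriesToQuotient P α hJ n) = powerSeriesToQuotient P α hJ m := by
  ext g
  obtain ⟨a, ha⟩ := exists_X_pow_dvd_sub_tensorToPowerSeries α (N * n) g
  rw [RingHom.comp_apply, (powerSeriesToQuotient_eq_iff α hJ n g a).2 ha,
    (powerSeriesToQuotient_eq_iff α hJ m g a).2
      ((pow_dvd_pow _ (Nat.mul_le_mul_left N hle)).trans ha)]
  rfl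

variable (P) in
/-- The map from `P⟦X⟧` to the completion of `P ⊗ k⟦X⟧`. -/
def powerSeriesToCompletion : P⟦X⟧ →+* AdicCompletion (tensorIdeal (k := k) P J) (P ⊗[k] Q) :=
  AdicCompletion.liftRingHom _ (powerSeriesToQuotient P α hJ)
    (fun hle => factorPow_powerSeriesToQuotient P α hJ hle)

theorem evalₐ_powerSeriesToCompletion (n : ℕ) (g : P⟦X⟧) :
    AdicCompletion.evalₐ _ n (powerSeriesToCompletion P α hJ g) =
      powerSeriesToQuotient P α hJ n g :=
  AdicCompletion.evalₐ_liftRingHom _ _ _ _ _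

variable (P) in
theorem powerSeriesToCompletion_bijective (hN : 0 < N) :
    Function.Bijective (powerSeriesToCompletion P α hJ) := by
  have hle : ∀ j, j ≤ N * j := fun j => Nat.le_mul_of_pos_left j hN
  constructor
  · rw [injective_iff_map_eq_zero]
    intro g hg
    refine eq_zero_of_forall_X_pow_dvd hle fun n => ?_
    have := evalₐ_powerSeriesToCompletion α hJ n g
    rw [hg, map_zero, ← map_zero (Ideal.Quotient.mk _), eq_comm,
      powerSeriesToQuotient_eq_iff] at this
    simpa using this
  · intro z
    have h : ∀ n, ∃ a, AdicCompletion.evalₐ _ n z = Ideal.Quotient.mk _ a :=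
      fun n => (Ideal.Quotient.mk_surjective (AdicCompletion.evalₐ _ n z)).imp fun _ => Eq.symm
    choose a ha using h
    -- The representatives `a n` need have no limit in `P ⊗ Q`, but their images in `P⟦X⟧` do.
    obtain ⟨g, hg⟩ := exists_powerSeries_limit (M := fun j => N * j)
      (fun _ _ h => Nat.mul_le_mul_left N h) hle (fun n => tensorToPowerSeries P α (a n)) (by
        intro n
        rw [← map_sub, X_pow_dvd_tensorToPowerSeries_iff, ← Ideal.mem_span_singleton,
          ← tensorIdeal_pow α hJ, ← Ideal.Quotient.eq, ← ha n]
        obtain ⟨y, rfl⟩ := AdicCompletion.mk_surjective _ _ z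
        have h1 := ha (n + 1)
        rw [AdicCompletion.evalₐ_mk] at h1 ⊢
        rw [← AdicCompletion.Ideal.mk_eq_mk _ n.le_succ y]
        rw [Ideal.Quotient.eq] at h1 ⊢
        rw [← neg_sub, neg_mem_iff]
        exact Ideal.pow_le_pow_right n.le_succ h1)
    refine ⟨g, AdicCompletion.ext_evalₐ fun n => ?_⟩
    rw [evalₐ_powerSeriesToCompletion, ha, powerSeriesToQuotient_eq_iff]
    exact hg n

variable (P) in
/-- The completion of `P ⊗ k⟦X⟧` along a power of `X` is `P⟦X⟧`. -/
def completionEquiv (hN : 0 < N) :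
    P⟦X⟧ ≃+* AdicCompletion (tensorIdeal (k := k) P J) (P ⊗[k] Q) :=
  RingEquiv.ofBijective _ (powerSeriesToCompletion_bijective P α hJ hN)

theorem evalₐ_adicCompletionMap {A B : Type*} [CommRing A] [CommRing B] (f : A →+* B)
    (I : Ideal A) (J : Ideal B) (h : I.map f ≤ J) (n : ℕ) (z : AdicCompletion I A) (a : A)
    (ha : AdicCompletion.evalₐ I n z = Ideal.Quotient.mk _ a) :
    AdicCompletion.evalₐ J n (adicCompletionMap f I J h z) = Ideal.Quotient.mk _ (f a) := by
  unfold adicCompletionMap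
  -- The compatibility proof inside `adicCompletionMap` becomes a local hypothesis, which
  -- `assumption` then supplies to `evalₐ_liftRingHom`.
  generalize_proofs
  rw [@AdicCompletion.evalₐ_liftRingHom _ _ _ _ J _ (by assumption) n z]
  rw [RingHom.comp_apply]
  refine (congrArg _ ha).trans ?_
  rw [Ideal.quotientMap_mk]

variable {P' Q' : Type*} [CommRing P'] [CommRing Q'] [Algebra k P'] [Algebra k Q']
  (α' : k⟦X⟧ ≃ₐ[k] Q') {N' : ℕ} {J' : Ideal Q'} (hJ' : J' = Ideal.span {α' (X ^ N')})

theorem map_tensorIdeal_le (u : P →ₐ[k] P') (v : Q →ₐ[k] Q') {J : Ideal Q} {J' : Ideal Q'}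
    (h : J.map v ≤ J') :
    (tensorIdeal (k := k) P J).map (Algebra.TensorProduct.map u v).toRingHom ≤
      tensorIdeal (k := k) P' J' := by
  rw [Ideal.map_le_iff_le_comap, Ideal.map_le_iff_le_comap]
  intro x hx
  have h := Ideal.mem_map_of_mem
    (Algebra.TensorProduct.includeRight : Q' →ₐ[k] P' ⊗[k] Q') (h (Ideal.mem_map_of_mem v hx))
  rw [Ideal.mem_comap, Ideal.mem_comap]
  simpa using h

/-- The formula is checked on pure tensors and then extended to the completion by approximating `g`
by tensors. -/
theorem adicCompletionMap_powerSeriesToCompletion {p : ℕ} (hp : p ≠ 0) (u : P →ₐ[k] P')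
    (v : Q →ₐ[k] Q') (hv : ∀ f, v (α f) = α' (expand p hp f)) (hNN' : N' ≤ p * N)
    (h : (tensorIdeal (k := k) P J).map (Algebra.TensorProduct.map u v).toRingHom ≤
      tensorIdeal (k := k) P' J') (g : P⟦X⟧) :
    adicCompletionMap (Algebra.TensorProduct.map u v).toRingHom _ _ h
      (powerSeriesToCompletion P α hJ g) =
    powerSeriesToCompletion P' α' hJ' (expand p hp (PowerSeries.map u.toRingHom g)) := by
  have hγ : ∀ a : P ⊗[k] Q, tensorToPowerSeries P' α' (Algebra.TensorProduct.map u v a) =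
      expand p hp (PowerSeries.map u.toRingHom (tensorToPowerSeries P α a)) := by
    intro a
    induction a with
    | zero => simp
    | add a b ha hb => simp only [map_add, ha, hb]
    | tmul r q =>
      obtain ⟨f, rfl⟩ := α.surjective q
      rw [Algebra.TensorProduct.map_tmul, hv, tensorToPowerSeries_tmul, tensorToPowerSeries_tmul,
        map_mul, map_mul, PowerSeries.map_expand, PowerSeries.map_C, expand_C,
        ← RingHom.comp_apply (PowerSeries.map u.toRingHom), ← PowerSeries.map_comp]
      congr 4
      exact u.comp_algebraMap.symm
  refine AdicCompletion.ext_evalₐ fun n => ?_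
  obtain ⟨a, ha⟩ := exists_X_pow_dvd_sub_tensorToPowerSeries α (N * n) g
  rw [evalₐ_adicCompletionMap _ _ _ h n _ a
    ((evalₐ_powerSeriesToCompletion α hJ n g).trans
      ((powerSeriesToQuotient_eq_iff α hJ n g a).2 ha)),
    evalₐ_powerSeriesToCompletion, eq_comm, powerSeriesToQuotient_eq_iff]
  -- Expansion improves the precision from `N * n` to `p * N * n`, which is at least `N' * n`.
  have h1 := X_pow_dvd_expand hp (X_pow_dvd_map u.toRingHom ha)
  rw [map_sub, map_sub, ← hγ, ← mul_assoc] at h1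
  exact (pow_dvd_pow _ (Nat.mul_le_mul_right n hNN')).trans h1

end CompletedTensor

variable {p : ℕ} [Fact p.Prime]

/-! ### Towers whose reductions are truncated power series rings -/

/-- A presentation of the reductions of a tower as `K⟦X⟧ / (X ^ (p ^ i))`, in which the transition
maps act on `K` through `ψ` and send `X` to `X ^ p`. -/
structure PowerSeriesPresentation (p : ℕ) [Fact p.Prime] (T : RingTower) (I : Ideal (T.obj 0))
    {K : Type*} [CommRing K] (ψ : K →+* K) where
  toRed : ∀ i, K⟦X⟧ →+* T.Red I i
  toRed_surjective : ∀ i, Function.Surjective (toRed i)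
  toRed_eq_zero_iff : ∀ i f, toRed i f = 0 ↔ (X : K⟦X⟧) ^ p ^ i ∣ f
  redMap_toRed : ∀ i f, T.redMap I i (toRed i f) =
    toRed (i + 1) (expand p (Fact.out : p.Prime).ne_zero (PowerSeries.map ψ f))

namespace PowerSeriesPresentation

variable {T : RingTower} {I : Ideal (T.obj 0)} {K : Type*} [CommRing K] {ψ : K →+* K}
  (E : PowerSeriesPresentation p T I ψ)

theorem toRed_eq_iff (i : ℕ) (f g : K⟦X⟧) :
    E.toRed i f = E.toRed i g ↔ (X : K⟦X⟧) ^ p ^ i ∣ f - g := by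
  rw [← sub_eq_zero, ← map_sub, E.toRed_eq_zero_iff]

theorem redMapOfEq_toRed {i j : ℕ} (h : j = i + 1) (f : K⟦X⟧) :
    T.redMapOfEq I h (E.toRed i f) =
      E.toRed j (expand p (Fact.out : p.Prime).ne_zero (PowerSeries.map ψ f)) := by
  subst h
  exact E.redMap_toRed i f

include E in
-- The coefficient of `X ^ (p * d)` in the expansion is `ψ` of the `d`-th one, and `d < p ^ i` gives
-- `p * d < p ^ (i + 1)`.
theorem redMap_injective (hψ : Function.Injective ψ) (i : ℕ) :
    Function.Injective (T.redMap I i) := by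
  rw [injective_iff_map_eq_zero]
  intro x hx
  obtain ⟨f, rfl⟩ := E.toRed_surjective i x
  rw [E.redMap_toRed, E.toRed_eq_zero_iff, X_pow_dvd_iff] at hx
  rw [E.toRed_eq_zero_iff, X_pow_dvd_iff]
  intro d hd
  have hpos := (Fact.out : p.Prime).pos
  have := hx (p * d) (by rw [pow_succ']; exact Nat.mul_lt_mul_of_pos_left hd hpos)
  rw [coeff_expand_mul, coeff_map] at this
  exact (map_eq_zero_iff ψ hψ).1 this

variable {σ : K ≃+* K} (hσ : ∀ x, ψ (σ x) = x ^ p)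

include hσ in
-- `ψ ∘ σ` is the `p`-th power map, which commutes with the ring map `ψ`; cancelling the injective
-- `ψ` leaves `σ ∘ ψ = ψ ∘ σ`.
theorem map_comp_comm (hψ : Function.Injective ψ) : Commute ψ (σ.symm : K →+* K) := by
  have h : ∀ x, σ (ψ x) = ψ (σ x) := fun x => hψ (by rw [hσ, hσ, map_pow])
  refine RingHom.ext fun x => σ.injective ?_
  change σ (ψ (σ.symm x)) = σ (σ.symm (ψ x))
  rw [h, RingEquiv.apply_symm_apply, RingEquiv.apply_symm_apply]

/-! ### Frobenius projections in characteristic `p`. -/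

section Frobenius

variable [CharP K p]

include hσ in
-- In characteristic `p`, `f ^ p` arises by raising the coefficients and the variable to the `p`-th
-- power. Since the left side is a transition map applied to `σ(f)`, this identifies the Frobenius
-- projection with `σ` on coefficients.
theorem expand_map_map (f : K⟦X⟧) :
    expand p (Fact.out : p.Prime).ne_zero
      (PowerSeries.map ψ (PowerSeries.map (σ : K →+* K) f)) = f ^ p := by
  have h : ψ.comp (σ : K →+* K) = frobenius K p := RingHom.ext hσ
  rw [← RingHom.comp_apply (PowerSeries.map ψ), ← PowerSeries.map_comp, h, ← PowerSeries.map_expand]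
  exact MvPowerSeries.map_frobenius_expand p _

include E hσ in
theorem isPurelyInseparable (hψ : Function.Injective ψ) (hI : (p : T.obj 0) ∈ I) :
    IsPurelyInseparable p T I where
  mem := hI
  redMap_injective := E.redMap_injective hψ
  frobenius_mem_range i x := by
    obtain ⟨f, rfl⟩ := E.toRed_surjective (i + 1) x
    exact ⟨E.toRed i (PowerSeries.map (σ : K →+* K) f), by
      rw [E.redMap_toRed, expand_map_map hσ, map_pow]⟩

include hσ in
theorem frobProj_toRed (h : IsPurelyInseparable p T I) (i : ℕ) (f : K⟦X⟧) :
    h.frobProj i (E.toRed (i + 1) f) = E.toRed i (PowerSeries.map (σ : K →+* K) f) := by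
  apply h.redMap_injective i
  rw [h.redMap_frobProj, E.redMap_toRed, expand_map_map hσ, map_pow]

theorem map_map_symm (f : K⟦X⟧) :
    PowerSeries.map (σ : K →+* K) (PowerSeries.map (σ.symm : K →+* K) f) = f := by
  ext; simp

include E hσ in
theorem frobProj_surjective (h : IsPurelyInseparable p T I) (i : ℕ) :
    Function.Surjective (h.frobProj i) := by
  intro x
  obtain ⟨f, rfl⟩ := E.toRed_surjective i x
  exact ⟨E.toRed (i + 1) (PowerSeries.map (σ.symm : K →+* K) f), by
    rw [E.frobProj_toRed hσ, map_map_symm]⟩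

include hσ in
-- The automorphism `σ` does not affect divisibility by powers of `X`, so the kernel is that of the
-- truncation from `X ^ p ^ (i + 1)` to `X ^ p ^ i`.
theorem ker_frobProj (h : IsPurelyInseparable p T I) (i : ℕ) :
    RingHom.ker (h.frobProj i) = Ideal.span {E.toRed (i + 1) (X ^ p ^ i)} := by
  ext x
  obtain ⟨f, rfl⟩ := E.toRed_surjective (i + 1) x
  rw [RingHom.mem_ker, E.frobProj_toRed hσ, E.toRed_eq_zero_iff, Ideal.mem_span_singleton]
  constructor
  · intro h1
    obtain ⟨g, rfl⟩ : (X : K⟦X⟧) ^ p ^ i ∣ f :=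
      X_pow_dvd_iff.2 fun d hd => by simpa using X_pow_dvd_iff.1 h1 d hd
    exact ⟨E.toRed (i + 1) g, map_mul _ _ _⟩
  · rintro ⟨y, hy⟩
    obtain ⟨g, rfl⟩ := E.toRed_surjective (i + 1) y
    rw [← map_mul, E.toRed_eq_iff] at hy
    refine X_pow_dvd_map _ ?_
    rw [← dvd_sub_left (Dvd.intro g rfl)]
    exact (pow_dvd_pow _ (Nat.pow_le_pow_right (Fact.out : p.Prime).pos i.le_succ)).trans hy

/-! ### The tilt -/

/-- The map from `K⟦X⟧` to the small tilt. -/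
def toTilt (h : IsPurelyInseparable p T I) (i : ℕ) : K⟦X⟧ →+* h.smallTilt i :=
  RingHom.codRestrict
    (RingHom.pi fun j => (E.toRed (i + j)).comp (PowerSeries.map ((σ.symm : K →+* K) ^ j)))
    (h.smallTilt i)
    (fun f j => by
      refine (E.frobProj_toRed hσ h (i + j) _).trans (congrArg (E.toRed (i + j)) ?_)
      rw [pow_succ']
      exact map_map_symm (PowerSeries.map ((σ.symm : K →+* K) ^ j) f))

theorem toTilt_apply (h : IsPurelyInseparable p T I) (i j : ℕ) (f : K⟦X⟧) :
    (E.toTilt hσ h i f).1 j = E.toRed (i + j) (PowerSeries.map ((σ.symm : K →+* K) ^ j) f) := rfl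

theorem projZero_toTilt (h : IsPurelyInseparable p T I) (i : ℕ) (f : K⟦X⟧) :
    h.projZero i (E.toTilt hσ h i f) = E.toRed i f := by
  refine (E.toTilt_apply hσ h i 0 f).trans (congrArg (E.toRed i) ?_)
  rw [pow_zero]
  ext; simp

/-- Applying `σ ^ j` in the `j`-th coordinate turns the inverse system into the plain truncations
`K⟦X⟧/(X ^ p ^ (i + j))`, whose limit is `K⟦X⟧`. -/
theorem toTilt_bijective (h : IsPurelyInseparable p T I) (i : ℕ) :
    Function.Bijective (E.toTilt hσ h i) := by
  have hp := (Fact.out : p.Prime).one_lt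
  have hle : ∀ j, j ≤ p ^ (i + j) := fun j =>
    (Nat.le_add_left j i).trans (Nat.lt_pow_self hp).le
  have hmono : Monotone fun j => p ^ (i + j) := fun a b hab =>
    Nat.pow_le_pow_right hp.le (Nat.add_le_add_left hab i)
  have h1 : (σ : K →+* K) * (σ.symm : K →+* K) = 1 := RingHom.ext σ.apply_symm_apply
  have h2 : (σ.symm : K →+* K) * (σ : K →+* K) = 1 := RingHom.ext σ.symm_apply_apply
  have hinv : ∀ j, ((σ : K →+* K) ^ j) * ((σ.symm : K →+* K) ^ j) = 1 := fun j => by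
    rw [← (show Commute (σ : K →+* K) (σ.symm : K →+* K) from h1.trans h2.symm).mul_pow, h1,
      one_pow]
  have hinv' : ∀ j, ((σ.symm : K →+* K) ^ j) * ((σ : K →+* K) ^ j) = 1 := fun j => by
    rw [← (show Commute (σ.symm : K →+* K) (σ : K →+* K) from h2.trans h1.symm).mul_pow, h2,
      one_pow]
  have hid : ∀ f : K⟦X⟧, PowerSeries.map (1 : K →+* K) f = f := fun f => by ext; simp
  constructor
  · rw [injective_iff_map_eq_zero]
    intro f hf
    refine eq_zero_of_forall_X_pow_dvd hle fun j => ?_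
    have h1 : (E.toTilt hσ h i f).1 j = 0 := by rw [hf]; rfl
    rw [toTilt_apply, E.toRed_eq_zero_iff] at h1
    have h2 := X_pow_dvd_map ((σ : K →+* K) ^ j) h1
    rwa [← RingHom.comp_apply (PowerSeries.map _), ← PowerSeries.map_comp, ← RingHom.mul_def,
      hinv, hid] at h2
  · intro z
    choose g hg using fun j => E.toRed_surjective (i + j) (z.1 j)
    -- Membership in the tilt says exactly that the untwisted representatives agree modulo `X ^ p ^
    -- (i + j)`.
    obtain ⟨f, hf⟩ := exists_powerSeries_limit hmono hle
      (fun j => PowerSeries.map ((σ : K →+* K) ^ j) (g j)) (by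
        intro j
        have h1 : E.toRed (i + j) (PowerSeries.map (σ : K →+* K) (g (j + 1))) =
            E.toRed (i + j) (g j) := by
          rw [hg, ← E.frobProj_toRed hσ h]
          exact (congrArg _ (hg (j + 1))).trans (z.2 j)
        rw [E.toRed_eq_iff] at h1
        have h2 := X_pow_dvd_map ((σ : K →+* K) ^ j) h1
        rwa [map_sub, ← RingHom.comp_apply (PowerSeries.map _), ← PowerSeries.map_comp,
          ← RingHom.mul_def, ← pow_succ] at h2)
    refine ⟨f, Subtype.ext (funext fun j => ?_)⟩
    rw [toTilt_apply, ← hg, E.toRed_eq_iff]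
    have h2 := X_pow_dvd_map ((σ.symm : K →+* K) ^ j) (hf j)
    rwa [map_sub, ← RingHom.comp_apply (PowerSeries.map _) _ (g j), ← PowerSeries.map_comp,
      ← RingHom.mul_def, hinv', hid] at h2

/-- The small tilt is a power series ring. -/
def tiltEquiv (h : IsPurelyInseparable p T I) (i : ℕ) : K⟦X⟧ ≃+* h.smallTilt i :=
  RingEquiv.ofBijective _ (E.toTilt_bijective hσ h i)

/-- In the `j`-th coordinate `ψ` has to be moved past the twist `σ⁻ʲ`, which is what `map_comp_comm`
allows. -/
theorem tiltMap_toTilt (hψ : Function.Injective ψ) (h : IsPurelyInseparable p T I) (i : ℕ)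
    (f : K⟦X⟧) :
    h.tiltMap i (E.toTilt hσ h i f) = E.toTilt hσ h (i + 1)
      (expand p (Fact.out : p.Prime).ne_zero (PowerSeries.map ψ f)) := by
  refine Subtype.ext (funext fun j => ?_)
  rw [toTilt_apply]
  refine (E.redMapOfEq_toRed (Nat.add_right_comm i 1 j) _).trans (congrArg _ ?_)
  rw [PowerSeries.map_expand, ← RingHom.comp_apply (PowerSeries.map _),
    ← RingHom.comp_apply (PowerSeries.map _), ← PowerSeries.map_comp, ← PowerSeries.map_comp,
    ← RingHom.mul_def, ← RingHom.mul_def, ((map_comp_comm hσ hψ).pow_right j).eq]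

/-- For the tower `V_i` this shows that the ideal of completion is generated by a power of `X`. -/
theorem ker_projZero (h : IsPurelyInseparable p T I) (i : ℕ) :
    RingHom.ker (h.projZero i) = Ideal.span {E.tiltEquiv hσ h i (X ^ p ^ i)} := by
  ext z
  obtain ⟨f, rfl⟩ := (E.tiltEquiv hσ h i).surjective z
  rw [RingHom.mem_ker, Ideal.mem_span_singleton, map_dvd_iff, ← E.toRed_eq_zero_iff]
  exact Eq.congr_left (E.projZero_toTilt hσ h i f)

end Frobenius

end PowerSeriesPresentation

/-! ### Towers obtained by adjoining roots of `p` -/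

section AdjoinPRoot

variable {B : Type*} [CommRing B]

theorem adjoinPRoot_root_pow (i : ℕ) :
    (AdjoinRoot.root (Polynomial.X ^ p ^ i - Polynomial.C (p : B)) : AdjoinPRoot B p i) ^ p ^ i =
      p := by
  have h := AdjoinRoot.eval₂_root (Polynomial.X ^ p ^ i - Polynomial.C (p : B))
  simp only [Polynomial.eval₂_sub, Polynomial.eval₂_pow, Polynomial.eval₂_X,
      Polynomial.eval₂_C] at h
  exact (sub_eq_zero.1 h).trans (map_natCast _ p)

theorem adjoinPRoot_monic (i : ℕ) :
    (Polynomial.X ^ p ^ i - Polynomial.C (p : B)).Monic :=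
  Polynomial.monic_X_pow_sub_C _ (pow_ne_zero _ (Fact.out : p.Prime).ne_zero)

/-- The defining polynomial is monic, so the ring is free over `B` and torsion can be tested on
coordinates. -/
theorem adjoinPRoot_eq_zero_of_p_mul (hB : ∀ b : B, (p : B) * b = 0 → b = 0) (i : ℕ)
    (x : AdjoinPRoot B p i) (hx : (p : AdjoinPRoot B p i) * x = 0) : x = 0 := by
  have := (adjoinPRoot_monic (B := B) (p := p) i).free_adjoinRoot
  have b := Module.Free.chooseBasis B (AdjoinPRoot B p i)
  refine b.ext_elem fun j => ?_
  rw [map_zero, Finsupp.zero_apply]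
  apply hB
  have h : (p : B) • x = 0 := 
    (Nat.cast_smul_eq_nsmul B p x).trans ((nsmul_eq_mul p x).trans hx)
  simpa using congrArg (fun y => b.repr y j) h

/-- The reduction of `B[p ^ (1 / p ^ i)]` modulo `p`, as a quotient of `(B / p)⟦X⟧`. -/
def adjoinPRootReduction (B : Type*) [CommRing B] (p : ℕ) (i : ℕ) :
    AdjoinPRoot B p i →+* (B ⧸ Ideal.span {(p : B)})⟦X⟧ ⧸
      Ideal.span {(X : (B ⧸ Ideal.span {(p : B)})⟦X⟧) ^ p ^ i} :=
  AdjoinRoot.lift ((Ideal.Quotient.mk _).comp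
    ((PowerSeries.C (R := B ⧸ Ideal.span {(p : B)})).comp (Ideal.Quotient.mk _)))
    (Ideal.Quotient.mk _ X) (by
      have hp : Ideal.Quotient.mk (Ideal.span {(p : B)}) (p : B) = 0 :=
        Ideal.Quotient.eq_zero_iff_mem.2 (Ideal.mem_span_singleton_self _)
      rw [Polynomial.eval₂_sub, Polynomial.eval₂_pow, Polynomial.eval₂_X, Polynomial.eval₂_C,
        RingHom.comp_apply, RingHom.comp_apply, hp, map_zero, map_zero, sub_zero, ← map_pow,
        Ideal.Quotient.eq_zero_iff_mem]
      exact Ideal.mem_span_singleton_self _)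

theorem adjoinPRootReduction_mk (i : ℕ) (f : Polynomial B) :
    adjoinPRootReduction B p i (AdjoinRoot.mk _ f) = Ideal.Quotient.mk _
      ((f.map (Ideal.Quotient.mk (Ideal.span {(p : B)})) :
        Polynomial (B ⧸ Ideal.span {(p : B)})) : (B ⧸ Ideal.span {(p : B)})⟦X⟧) := by
  have : (adjoinPRootReduction B p i).comp (AdjoinRoot.mk _) = (Ideal.Quotient.mk _).comp
      ((Polynomial.coeToPowerSeries.ringHom (R := B ⧸ Ideal.span {(p : B)})).comp
        (Polynomial.mapRingHom (Ideal.Quotient.mk (Ideal.span {(p : B)})))) := by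
    refine Polynomial.ringHom_ext (fun b => ?_) ?_
    · simp [adjoinPRootReduction]
    · simp [adjoinPRootReduction]
  exact congr($this f)

theorem adjoinPRootReduction_of (i : ℕ) (b : B) :
    adjoinPRootReduction B p i (AdjoinRoot.of _ b) =
      Ideal.Quotient.mk _ (PowerSeries.C (Ideal.Quotient.mk _ b)) := by
  simp [adjoinPRootReduction]

theorem adjoinPRootReduction_root (i : ℕ) :
    adjoinPRootReduction B p i (AdjoinRoot.root _) = Ideal.Quotient.mk _ X := by
  simp [adjoinPRootReduction]

theorem adjoinPRootReduction_surjective (i : ℕ) :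
    Function.Surjective (adjoinPRootReduction B p i) := by
  intro y
  obtain ⟨g, rfl⟩ := Ideal.Quotient.mk_surjective y
  obtain ⟨f, hf⟩ := Polynomial.map_surjective _ (Ideal.Quotient.mk_surjective
    (I := Ideal.span {(p : B)})) (trunc (p ^ i) g)
  refine ⟨AdjoinRoot.mk _ f, ?_⟩
  rw [adjoinPRootReduction_mk, hf, eq_comm, Ideal.Quotient.eq, Ideal.mem_span_singleton]
  exact X_pow_dvd_sub_trunc _ _

theorem ker_adjoinPRootReduction (i : ℕ) :
    RingHom.ker (adjoinPRootReduction B p i) = Ideal.span {(p : AdjoinPRoot B p i)} := by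
  ext x
  rw [RingHom.mem_ker, Ideal.mem_span_singleton]
  constructor
  · obtain ⟨f, rfl⟩ := AdjoinRoot.mk_surjective x
    intro hx
    rw [adjoinPRootReduction_mk, Ideal.Quotient.eq_zero_iff_mem, Ideal.mem_span_singleton,
      X_pow_dvd_iff] at hx
    have h1 : ∀ d, d < p ^ i → (p : B) ∣ f.coeff d := fun d hd => by
      have := hx d hd
      rw [Polynomial.coeff_coe, Polynomial.coeff_map, Ideal.Quotient.eq_zero_iff_mem,
        Ideal.mem_span_singleton] at this
      exact this
    rw [f.as_sum_range_C_mul_X_pow, map_sum]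
    refine Finset.dvd_sum fun d _ => ?_
    rw [map_mul, map_pow, AdjoinRoot.mk_X]
    -- Below degree `p ^ i` the coefficient is divisible by `p`; from there on the monomial is,
    -- since the root to the power `p ^ i` equals `p`.
    rcases lt_or_ge d (p ^ i) with hd | hd
    · obtain ⟨c, hc⟩ := h1 d hd
      refine Dvd.dvd.mul_right ?_ _
      exact ⟨_, (congrArg ((AdjoinRoot.mk _).comp Polynomial.C) hc).trans
        ((map_mul _ _ _).trans (congrArg (· * _) (map_natCast _ p)))⟩
    · refine Dvd.dvd.mul_left ?_ _
      rw [← Nat.add_sub_cancel' hd, pow_add, adjoinPRoot_root_pow]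
      exact Dvd.intro _ rfl
  · rintro ⟨y, rfl⟩
    have hp : Ideal.Quotient.mk (Ideal.span {(p : B)}) (p : B) = 0 :=
      Ideal.Quotient.eq_zero_iff_mem.2 (Ideal.mem_span_singleton_self _)
    rw [map_mul, ← map_natCast (AdjoinRoot.of _) p, adjoinPRootReduction_of, hp, map_zero,
      map_zero, zero_mul]

end AdjoinPRoot

/-- An identification of a tower with the tower of the rings `B[p ^ (1 / p ^ i)]`, in which the
transition maps act on `B` through `ψ`. -/
structure RootPresentation (p : ℕ) (T : RingTower) {B : Type*} [CommRing B] (ψ : B →+* B) where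
  equiv : ∀ i, AdjoinPRoot B p i ≃+* T.obj i
  map_of : ∀ i b, T.map i (equiv i (AdjoinRoot.of _ b)) = equiv (i + 1) (AdjoinRoot.of _ (ψ b))
  map_root : ∀ i, T.map i (equiv i (AdjoinRoot.root _)) = equiv (i + 1) (AdjoinRoot.root _ ^ p)

theorem levelIdeal_eq_span (T : RingTower) {I : Ideal (T.obj 0)}
    (hI : I = Ideal.span {(p : T.obj 0)}) (i : ℕ) :
    T.levelIdeal I i = Ideal.span {(p : T.obj i)} := by
  rw [RingTower.levelIdeal, hI, Ideal.map_span, Set.image_singleton, map_natCast]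

/-- Maximal ideals contract to maximal ideals along integral maps. -/
theorem mem_ringJacobson_of_isIntegral {B S : Type*} [CommRing B] [CommRing S] (g : B →+* S)
    (hg : g.IsIntegral) {b : B} (hb : b ∈ Ring.jacobson B) : g b ∈ Ring.jacobson S := by
  rw [Ring.jacobson_eq_sInf_isMaximal, Ideal.mem_sInf] at hb ⊢
  intro M hM
  have : M.IsMaximal := hM
  exact hb (Ideal.isMaximal_comap_of_isIntegral_of_isMaximal' g hg M)

namespace RootPresentation

variable {T : RingTower} {B : Type*} [CommRing B] {ψ : B →+* B} (E : RootPresentation p T ψ)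
  {I : Ideal (T.obj 0)} (hI : I = Ideal.span {(p : T.obj 0)})

/-- The reduction modulo `p` of the `i`-th layer. -/
def reduction (i : ℕ) : T.obj i →+* (B ⧸ Ideal.span {(p : B)})⟦X⟧ ⧸
      Ideal.span {(X : (B ⧸ Ideal.span {(p : B)})⟦X⟧) ^ p ^ i} :=
  (adjoinPRootReduction B p i).comp (E.equiv i).symm.toRingHom

theorem reduction_equiv (i : ℕ) (x : AdjoinPRoot B p i) :
    E.reduction i (E.equiv i x) = adjoinPRootReduction B p i x :=
  congrArg _ ((E.equiv i).symm_apply_apply x)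

theorem reduction_surjective (i : ℕ) : Function.Surjective (E.reduction i) :=
  (adjoinPRootReduction_surjective i).comp (E.equiv i).symm.surjective

include hI in
theorem ker_reduction (i : ℕ) : RingHom.ker (E.reduction i) = T.levelIdeal I i := by
  rw [levelIdeal_eq_span T hI]
  ext x
  obtain ⟨x, rfl⟩ := (E.equiv i).surjective x
  rw [RingHom.mem_ker, reduction_equiv, ← RingHom.mem_ker, ker_adjoinPRootReduction,
    Ideal.mem_span_singleton, Ideal.mem_span_singleton, ← map_natCast (E.equiv i) p, map_dvd_iff]

variable {ψ' : B ⧸ Ideal.span {(p : B)} →+* B ⧸ Ideal.span {(p : B)}}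
  (hψ : ∀ b, ψ' (Ideal.Quotient.mk _ b) = Ideal.Quotient.mk _ (ψ b))

include hψ in
theorem reduction_map (i : ℕ) (x : T.obj i) (f : (B ⧸ Ideal.span {(p : B)})⟦X⟧)
    (h : Ideal.Quotient.mk _ f = E.reduction i x) :
    Ideal.Quotient.mk _ (expand p (Fact.out : p.Prime).ne_zero (PowerSeries.map ψ' f)) =
      E.reduction (i + 1) (T.map i x) := by
  have hle : Ideal.span {(X : (B ⧸ Ideal.span {(p : B)})⟦X⟧) ^ p ^ i} ≤
      (Ideal.span {(X : (B ⧸ Ideal.span {(p : B)})⟦X⟧) ^ p ^ (i + 1)}).comap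
        ((expand p (Fact.out : p.Prime).ne_zero).toRingHom.comp (PowerSeries.map ψ')) := by
    rw [Ideal.span_le, Set.singleton_subset_iff, SetLike.mem_coe, Ideal.mem_comap,
      Ideal.mem_span_singleton, pow_succ']
    exact X_pow_dvd_expand (Fact.out : p.Prime).ne_zero (X_pow_dvd_map _ dvd_rfl)
  -- Two ring maps out of `B[p^(1/p^i)]` agree once they agree on `B` and on the root.
  have key : (Ideal.quotientMap _ _ hle).comp (adjoinPRootReduction B p i) =
      ((E.reduction (i + 1)).comp (T.map i)).comp (E.equiv i).toRingHom := by
    refine AdjoinRoot.ringHom_ext (RingHom.ext fun b => ?_) ?_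
    · change Ideal.quotientMap _ _ hle (adjoinPRootReduction B p i (AdjoinRoot.of _ b)) =
        E.reduction (i + 1) (T.map i (E.equiv i (AdjoinRoot.of _ b)))
      rw [E.map_of, reduction_equiv, adjoinPRootReduction_of, adjoinPRootReduction_of,
        Ideal.quotientMap_mk, ← hψ]
      simp [expand_C]
    · change Ideal.quotientMap _ _ hle (adjoinPRootReduction B p i (AdjoinRoot.root _)) =
        E.reduction (i + 1) (T.map i (E.equiv i (AdjoinRoot.root _)))
      rw [E.map_root, reduction_equiv, map_pow, adjoinPRootReduction_root,
        adjoinPRootReduction_root, Ideal.quotientMap_mk]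
      simp
  obtain ⟨y, rfl⟩ := (E.equiv i).surjective x
  rw [reduction_equiv] at h
  exact (congrArg (Ideal.quotientMap _ _ hle) h).trans congr($key y)

/-- The power series presentation of the reductions of a tower of rings `B[p ^ (1 / p ^ i)]`. -/
def toPowerSeries : PowerSeriesPresentation p T I ψ' where
  toRed i := quotientLift (E.reduction i) (E.reduction_surjective i) (E.ker_reduction hI i)
    (Ideal.Quotient.mk _)
  toRed_surjective i x := by
    obtain ⟨x, rfl⟩ := Ideal.Quotient.mk_surjective x
    obtain ⟨f, hf⟩ := Ideal.Quotient.mk_surjective (E.reduction i x)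
    exact ⟨f, (quotientLift_eq_iff _ _ _ _ _ _).2 hf⟩
  toRed_eq_zero_iff i f := by
    rw [← map_zero (Ideal.Quotient.mk _), quotientLift_eq_iff, map_zero,
      Ideal.Quotient.eq_zero_iff_mem, Ideal.mem_span_singleton]
  redMap_toRed i f := by
    obtain ⟨x, hx⟩ := E.reduction_surjective i (Ideal.Quotient.mk _ f)
    rw [(quotientLift_eq_iff _ _ _ _ f x).2 hx.symm, eq_comm]
    exact (quotientLift_eq_iff _ _ _ _ _ (T.map i x)).2 (E.reduction_map hψ i x f hx.symm)

theorem toRed_eq_mk (i : ℕ) (f : (B ⧸ Ideal.span {(p : B)})⟦X⟧) (x : AdjoinPRoot B p i)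
    (h : adjoinPRootReduction B p i x = Ideal.Quotient.mk _ f) :
    (E.toPowerSeries hI hψ).toRed i f = Ideal.Quotient.mk _ (E.equiv i x) :=
  (quotientLift_eq_iff (E.reduction i) (E.reduction_surjective i) (E.ker_reduction hI i)
    (Ideal.Quotient.mk _) f (E.equiv i x)).2 (h.symm.trans (E.reduction_equiv i x).symm)

/-- Hence `p^(1/p)` of layer one reduces to `X ^ p ^ i` in layer `i + 1`, the generator found in
`ker_frobProj`. -/
theorem fromOne_root (i : ℕ) : T.fromOne i (E.equiv 1 (AdjoinRoot.root _)) =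
    E.equiv (i + 1) (AdjoinRoot.root _ ^ p ^ i) := by
  induction i with
  | zero =>
    exact (congrArg (E.equiv 1)
      ((congrArg (AdjoinRoot.root _ ^ ·) (pow_zero p)).trans (pow_one _))).symm
  | succ i ih =>
    change T.map (i + 1) (T.fromOne i _) = _
    rw [ih, map_pow, map_pow, E.map_root, ← map_pow, ← pow_mul, ← pow_succ']

include E in
theorem eq_zero_of_p_pow_mul (hB : ∀ b : B, (p : B) * b = 0 → b = 0) (i n : ℕ) (x : T.obj i)
    (hx : (p : T.obj i) ^ n * x = 0) : x = 0 := by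
  induction n with
  | zero => simpa using hx
  | succ n ih =>
    apply ih
    rw [pow_succ', mul_assoc] at hx
    obtain ⟨y, hy⟩ := (E.equiv i).surjective ((p : T.obj i) ^ n * x)
    rw [← hy, ← map_natCast (E.equiv i) p, ← map_mul, map_eq_zero_iff _ (E.equiv i).injective] at hx
    rw [← hy, adjoinPRoot_eq_zero_of_p_mul hB i y hx, map_zero]

variable {σ : (B ⧸ Ideal.span {(p : B)}) ≃+* (B ⧸ Ideal.span {(p : B)})}
  [CharP (B ⧸ Ideal.span {(p : B)}) p]

include E hI hψ in
theorem isPerfectoidTower (hψ' : Function.Injective ψ') (hσ : ∀ x, ψ' (σ x) = x ^ p)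
    (hB : ∀ b : B, (p : B) * b = 0 → b = 0) (hjac : (p : B) ∈ Ring.jacobson B) :
    IsPerfectoidTower p T I where
  toIsPurelyInseparable := (E.toPowerSeries hI hψ).isPurelyInseparable hσ hψ' (by
    rw [hI]; exact Ideal.mem_span_singleton_self _)
  frobProj_surjective := (E.toPowerSeries hI hψ).frobProj_surjective hσ _
  zariskian i := by
    rw [levelIdeal_eq_span T hI, Ideal.span_le, Set.singleton_subset_iff]
    have h := mem_ringJacobson_of_isIntegral ((E.equiv i).toRingHom.comp (AdjoinRoot.of _)) ?_ hjac
    · simpa using h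
    · have hfin := (adjoinPRoot_monic (B := B) (p := p) i).finite_adjoinRoot
      refine RingHom.IsIntegral.trans _ _ ?_ ((E.equiv i).toRingHom.isIntegral_of_surjective
        (E.equiv i).surjective)
      exact fun x => Algebra.IsIntegral.isIntegral (R := B) x
  principal := hI ▸ ⟨_, rfl⟩
  pillar := by
    -- The pillar `I₁` is generated by `p^(1/p)`.
    refine ⟨Ideal.span {E.equiv 1 (AdjoinRoot.root _)}, ⟨_, rfl⟩, ?_, fun i => ?_⟩
    · have h := (congrArg (AdjoinRoot.root _ ^ ·) (pow_one p).symm).trans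
        (adjoinPRoot_root_pow (B := B) (p := p) 1)
      rw [Ideal.span_singleton_pow, ← map_pow, levelIdeal_eq_span T hI]
      exact congrArg (fun x => Ideal.span {x}) ((congrArg _ h).trans (map_natCast (E.equiv 1) _))
    · rw [(E.toPowerSeries hI hψ).ker_frobProj hσ, Ideal.map_span, Set.image_singleton,
        Ideal.map_span, Set.image_singleton, E.fromOne_root,
        E.toRed_eq_mk hI hψ (i + 1) _ (AdjoinRoot.root _ ^ p ^ i)]
      rw [map_pow, adjoinPRootReduction_root, map_pow]
  mul_torsion i f _ x hx := by
    obtain ⟨n, hn⟩ := hx p (by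
      rw [levelIdeal_eq_span T hI]; exact Ideal.mem_span_singleton_self _)
    rw [E.eq_zero_of_p_pow_mul hB i n x hn, mul_zero]
  exists_torsion_bijection i := by
    have key : ∀ j (x : T.torsion I j), x.1 = 0 := fun j x => by
      obtain ⟨n, hn⟩ := x.2 p (by
        rw [levelIdeal_eq_span T hI]; exact Ideal.mem_span_singleton_self _)
      exact E.eq_zero_of_p_pow_mul hB j n x hn
    have hz : ∀ j, (0 : T.obj j) ∈ T.torsion I j := fun j f _ => ⟨0, mul_zero _⟩
    -- Both torsion sets are `{0}`, so the constant map is a bijection.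
    refine ⟨fun _ => ⟨0, hz i⟩, ⟨fun x y _ => Subtype.ext ((key _ x).trans (key _ y).symm),
      fun y => ⟨⟨0, hz _⟩, Subtype.ext (key _ y).symm⟩⟩, fun x => ?_⟩
    rw [key _ x, map_zero, map_zero, map_zero]

end RootPresentation

/-! ### The finite colimits of an endomorphism -/

section FiniteColim

variable {R : Type*} [CommRing R] (φ : R →+* R)

/-- The last index is terminal in `Fin (i + 1)`. The inverse sends `x` in the `j`-th copy to `φ ^ (i
- j)` of it. -/
theorem FiniteColim.of_last_bijective (i : ℕ) :
    Function.Bijective (FiniteColim.of φ i (Fin.last i)) := by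
  let g : FiniteColim φ i →+* R := Ring.DirectLimit.lift _ _ _
    (fun j : Fin (i + 1) => φ ^ (i - (j : ℕ))) (fun a b hab x => by
      have hab' : (a : ℕ) ≤ b := hab
      have hb : (b : ℕ) ≤ i := Nat.lt_succ_iff.1 b.2
      rw [← RingHom.comp_apply, ← RingHom.mul_def, ← pow_add]
      congr 2
      omega)
  have hg : ∀ j x, g (FiniteColim.of φ i j x) = (φ ^ (i - (j : ℕ))) x :=
    fun j x => Ring.DirectLimit.lift_of _ _ _ _ _
  constructor
  · refine Function.LeftInverse.injective (g := g) fun x => ?_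
    rw [hg]
    simp
  · intro z
    obtain ⟨j, x, rfl⟩ := Ring.DirectLimit.exists_of z
    exact ⟨_, Ring.DirectLimit.of_f (G := fun _ : Fin (i + 1) => R)
      (f := fun a b _ => ⇑(φ ^ ((b : ℕ) - (a : ℕ)))) (Fin.le_last j) x⟩

/-- The finite colimit is identified with its last copy of `R`. -/
def finiteColimEquiv (i : ℕ) : R ≃+* FiniteColim φ i :=
  RingEquiv.ofBijective _ (FiniteColim.of_last_bijective φ i)

/-- The last copy in `R_i` becomes the last but one in `R_(i+1)`, one application of `φ` away from
the end. -/
theorem transition_finiteColimEquiv (i : ℕ) (x : R) :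
    FiniteColim.transition φ i (finiteColimEquiv φ i x) = finiteColimEquiv φ (i + 1) (φ x) := by
  have h1 : FiniteColim.transition φ i (FiniteColim.of φ i (Fin.last i) x) =
      FiniteColim.of φ (i + 1) (Fin.last i).castSucc x := Ring.DirectLimit.lift_of _ _ _ _ _
  have h2 := Ring.DirectLimit.of_f (G := fun _ : Fin (i + 1 + 1) => R)
      (f := fun a b _ => ⇑(φ ^ ((b : ℕ) - (a : ℕ)))) (Fin.le_last (Fin.last i).castSucc) x
  refine h1.trans (h2.symm.trans ?_)
  simp
  rfl

end FiniteColim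

/-! ### Base change of `V[p ^ (1 / p ^ i)]` -/

section AdjoinPRootTensor

theorem adjoinPRoot_zero_bijective (p : ℕ) [Fact p.Prime] (B : Type*) [CommRing B] :
    Function.Bijective (AdjoinRoot.of (Polynomial.X ^ p ^ 0 - Polynomial.C (p : B))) := by
  let g : AdjoinPRoot B p 0 →+* B := AdjoinRoot.lift (RingHom.id B) p (by simp)
  refine ⟨Function.LeftInverse.injective (g := g) fun b => AdjoinRoot.lift_of _,
    Function.RightInverse.surjective (g := g) fun x => ?_⟩
  have hr := adjoinPRoot_root_pow (B := B) (p := p) 0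
  have h : ((AdjoinRoot.of _).comp g : AdjoinPRoot B p 0 →+* AdjoinPRoot B p 0) =
      RingHom.id _ := by
    refine AdjoinRoot.ringHom_ext (RingHom.ext fun b => ?_) ?_
    · exact congrArg (AdjoinRoot.of _) (show g (AdjoinRoot.of _ b) = b from AdjoinRoot.lift_of _)
    · refine (congrArg (AdjoinRoot.of _)
        (show g (AdjoinRoot.root _) = p from AdjoinRoot.lift_root _)).trans
          ((map_natCast (AdjoinRoot.of _) p).trans ?_)
      exact hr.symm.trans ((congrArg (AdjoinRoot.root _ ^ ·) (pow_zero p)).trans (pow_one _))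
  exact congr($h x)

variable (p : ℕ) (V P : Type*) [CommRing V] [CommRing P] [Algebra V P]

/-- The map `P[p ^ (1 / p ^ i)] → P ⊗ V[p ^ (1 / p ^ i)]`. -/
def adjoinPRootToTensor (i : ℕ) :
    AdjoinPRoot P p i →+* P ⊗[V] AdjoinPRoot V p i :=
  AdjoinRoot.lift Algebra.TensorProduct.includeLeftRingHom (1 ⊗ₜ AdjoinRoot.root _) (by
    have h := AdjoinRoot.eval₂_root (Polynomial.X ^ p ^ i - Polynomial.C (p : V))
    simp only [Polynomial.eval₂_sub, Polynomial.eval₂_pow, Polynomial.eval₂_X,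
      Polynomial.eval₂_C] at h ⊢
    rw [Algebra.TensorProduct.tmul_pow, one_pow, sub_eq_zero.1 h]
    have h1 := map_natCast ((Algebra.TensorProduct.includeRight :
      AdjoinPRoot V p i →ₐ[V] P ⊗[V] AdjoinPRoot V p i).toRingHom.comp (AdjoinRoot.of _)) p
    exact sub_eq_zero.2 (h1.trans (map_natCast Algebra.TensorProduct.includeLeftRingHom p).symm))

theorem adjoinPRootToTensor_of (i : ℕ) (b : P) :
    adjoinPRootToTensor p V P i (AdjoinRoot.of _ b) = b ⊗ₜ 1 := AdjoinRoot.lift_of _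

theorem adjoinPRootToTensor_root (i : ℕ) :
    adjoinPRootToTensor p V P i (AdjoinRoot.root _) = 1 ⊗ₜ AdjoinRoot.root _ :=
  AdjoinRoot.lift_root _

theorem X_pow_sub_C_dvd_map (i : ℕ) {S : Type*} [CommRing S] (f : V →+* S) :
    (Polynomial.X ^ p ^ i - Polynomial.C (p : S)) ∣
      (Polynomial.X ^ p ^ i - Polynomial.C (p : V)).map f := by
  simp

/-- The map `P ⊗ V[p ^ (1 / p ^ i)] → P[p ^ (1 / p ^ i)]`. -/
def tensorToAdjoinPRoot (i : ℕ) : P ⊗[V] AdjoinPRoot V p i →ₐ[V] AdjoinPRoot P p i :=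
  Algebra.TensorProduct.lift (AdjoinRoot.ofAlgHom V _)
    (AdjoinRoot.mapAlgHom (Algebra.ofId V P) _ _
      (X_pow_sub_C_dvd_map p V i _)) (fun _ _ => Commute.all _ _)

/-- Base change of `V[p ^ (1 / p ^ i)]`. -/
def adjoinPRootTensorEquiv (i : ℕ) : AdjoinPRoot P p i ≃+* P ⊗[V] AdjoinPRoot V p i :=
  RingEquiv.ofRingHom (adjoinPRootToTensor p V P i) (tensorToAdjoinPRoot p V P i).toRingHom
    (by
      -- This settles the tensors `1 ⊗ x`; general pure tensors follow by multiplying with `r ⊗ 1`.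
      have h : (adjoinPRootToTensor p V P i).comp
          (AdjoinRoot.mapAlgHom (Algebra.ofId V P) (Polynomial.X ^ p ^ i - Polynomial.C (p : V))
            (Polynomial.X ^ p ^ i - Polynomial.C (p : P)) (X_pow_sub_C_dvd_map p V i _)).toRingHom =
          (Algebra.TensorProduct.includeRight :
            AdjoinPRoot V p i →ₐ[V] P ⊗[V] AdjoinPRoot V p i).toRingHom := by
        refine AdjoinRoot.ringHom_ext (RingHom.ext fun v => ?_) ?_
        · refine (congrArg (adjoinPRootToTensor p V P i) (AdjoinRoot.map_of _ _ _
            (X_pow_sub_C_dvd_map p V i _) v)).trans ?_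
          refine (adjoinPRootToTensor_of p V P i _).trans ?_
          exact Algebra.TensorProduct.tmul_one_eq_one_tmul v
        · exact (congrArg (adjoinPRootToTensor p V P i) (AdjoinRoot.map_root _ _ _
            (X_pow_sub_C_dvd_map p V i _))).trans
            (adjoinPRootToTensor_root p V P i)
      refine RingHom.ext fun z => ?_
      change adjoinPRootToTensor p V P i (tensorToAdjoinPRoot p V P i z) = z
      induction z with
      | zero => rw [map_zero, map_zero]
      | add a b ha hb => rw [map_add, map_add, ha, hb]
      | tmul r x =>
        rw [tensorToAdjoinPRoot, Algebra.TensorProduct.lift_tmul, map_mul]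
        refine (congrArg₂ (· * ·) (adjoinPRootToTensor_of p V P i r) congr($h x)).trans ?_
        refine (Algebra.TensorProduct.tmul_mul_tmul _ _ _ _).trans ?_
        rw [mul_one, one_mul])
    (by
      refine AdjoinRoot.ringHom_ext (RingHom.ext fun b => ?_) ?_
      · change tensorToAdjoinPRoot p V P i (adjoinPRootToTensor p V P i (AdjoinRoot.of _ b)) = _
        rw [adjoinPRootToTensor_of, tensorToAdjoinPRoot, Algebra.TensorProduct.lift_tmul, map_one,
          mul_one]
        rfl
      · change tensorToAdjoinPRoot p V P i (adjoinPRootToTensor p V P i (AdjoinRoot.root _)) = _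
        rw [adjoinPRootToTensor_root, tensorToAdjoinPRoot, Algebra.TensorProduct.lift_tmul,
          map_one, one_mul]
        exact AdjoinRoot.map_root _ _ _ (X_pow_sub_C_dvd_map p V i _))

end AdjoinPRootTensor

/-! ### The towers `Vᵢ` and `Sᵢ` -/

section Towers

variable (p : ℕ) [Fact p.Prime] (V : Type*) [CommRing V] {R : Type*} [CommRing R]
  [Algebra V R] (φ : R →+* R)

theorem rootTower_map_root (i : ℕ) :
    (rootTower V p).map i (AdjoinRoot.root (Polynomial.X ^ p ^ i - Polynomial.C (p : V))) =
      (AdjoinRoot.root (Polynomial.X ^ p ^ (i + 1) - Polynomial.C (p : V)) ^ p :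
        AdjoinPRoot V p (i + 1)) := by
  have h : (Polynomial.X ^ p ^ i - Polynomial.C (p : V)).eval₂
      (Algebra.ofId V (AdjoinPRoot V p (i + 1))).toRingHom (AdjoinRoot.root _ ^ p) = 0 := by
    rw [Polynomial.eval₂_sub, Polynomial.eval₂_pow, Polynomial.eval₂_X, Polynomial.eval₂_C,
      ← pow_mul, ← pow_succ']
    exact sub_eq_zero.2 ((adjoinPRoot_root_pow (B := V) (p := p) (i + 1)).trans
      (map_natCast (AdjoinRoot.of _) p).symm)
  exact AdjoinRoot.liftAlgHom_root _ (Algebra.ofId V (AdjoinPRoot V p (i + 1))) _ h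

/-- The tower of the rings `V[p ^ (1 / p ^ i)]`. -/
def rootTowerPresentation :
    RootPresentation p (rootTower V p).toRingTower (RingHom.id V) where
  equiv _ := RingEquiv.refl _
  map_of i b := ((rootTower V p).map i).commutes b
  map_root i := rootTower_map_root p V i

/-- The `i`-th layer of the tower of finite colimits is isomorphic to `R`. -/
def phiTowerEquiv (i : ℕ) : R ≃+* (phiTower φ V).obj i := finiteColimEquiv φ i

theorem phiTower_map_phiTowerEquiv (i : ℕ) (x : R) :
    (phiTower φ V).map i (phiTowerEquiv V φ i x) = phiTowerEquiv V φ (i + 1) (φ x) :=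
  transition_finiteColimEquiv φ i x

/-- The `i`-th layer of the tower `Sᵢ` is isomorphic to `R[p ^ (1 / p ^ i)]`. -/
def sTowerEquiv (i : ℕ) : AdjoinPRoot R p i ≃+* (sTower V p φ).toRingTower.obj i :=
  (AdjoinRoot.mapRingEquiv (phiTowerEquiv V φ i) _ _ (by simp)).trans
    (adjoinPRootTensorEquiv p V ((phiTower φ V).obj i) i)

theorem sTowerEquiv_of (i : ℕ) (b : R) :
    sTowerEquiv p V φ i (AdjoinRoot.of _ b) = phiTowerEquiv V φ i b ⊗ₜ 1 :=
  (congrArg (adjoinPRootTensorEquiv p V ((phiTower φ V).obj i) i)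
    (AdjoinRoot.map_of _ _ _ (X_pow_sub_C_dvd_map p R i _) b)).trans
      (adjoinPRootToTensor_of p V _ i _)

theorem sTowerEquiv_root (i : ℕ) :
    sTowerEquiv p V φ i (AdjoinRoot.root _) = (1 : (phiTower φ V).obj i) ⊗ₜ[V]
      (AdjoinRoot.root (Polynomial.X ^ p ^ i - Polynomial.C (p : V)) : (rootTower V p).obj i) :=
  (congrArg (adjoinPRootTensorEquiv p V ((phiTower φ V).obj i) i)
    (AdjoinRoot.map_root _ _ _ (X_pow_sub_C_dvd_map p R i _))).trans
      (adjoinPRootToTensor_root p V _ i)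

/-- The tower `Sᵢ` is the tower of the rings `R[p ^ (1 / p ^ i)]`. -/
def sTowerPresentation : RootPresentation p (sTower V p φ).toRingTower φ where
  equiv i := sTowerEquiv p V φ i
  map_of i b := by
    rw [sTowerEquiv_of, sTowerEquiv_of]
    refine (Algebra.TensorProduct.map_tmul _ _ _ _).trans ?_
    rw [map_one, phiTower_map_phiTowerEquiv]
  map_root i := by
    rw [sTowerEquiv_root, map_pow, sTowerEquiv_root]
    refine (Algebra.TensorProduct.map_tmul _ _ _ _).trans ?_
    exact (congrArg₂ (· ⊗ₜ[V] ·) (map_one _) (rootTower_map_root p V i)).trans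
      ((Algebra.TensorProduct.tmul_pow _ _ _).trans (congrArg (· ⊗ₜ[V] _) (one_pow p))).symm

theorem algebraMap_rootTower_bijective :
    Function.Bijective (algebraMap V ((rootTower V p).obj 0)) :=
  adjoinPRoot_zero_bijective p V

theorem toSTowerZero_bijective : Function.Bijective (toSTowerZero V p φ) := by
  have h : ⇑(toSTowerZero V p φ) = sTowerEquiv p V φ 0 ∘ AdjoinRoot.of _ :=
    funext fun r => (sTowerEquiv_of p V φ 0 r).symm
  rw [h]
  exact (sTowerEquiv p V φ 0).bijective.comp (adjoinPRoot_zero_bijective p R)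

theorem map_span_p {R S : Type*} [CommRing R] [CommRing S] (ι : R →+* S) :
    (Ideal.span {(p : R)}).map ι = Ideal.span {(p : S)} := by
  rw [Ideal.map_span, Set.image_singleton, map_natCast]

theorem charP_quotient_span {R : Type*} [CommRing R] [IsLocalRing R]
    (h : (p : R) ∈ IsLocalRing.maximalIdeal R) : CharP (R ⧸ Ideal.span {(p : R)}) p := by
  have : Nontrivial (R ⧸ Ideal.span {(p : R)}) := by
    refine Ideal.Quotient.nontrivial_iff.2 fun htop => ?_
    have hle : Ideal.span {(p : R)} ≤ IsLocalRing.maximalIdeal R := by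
      rwa [Ideal.span_le, Set.singleton_subset_iff]
    exact (IsLocalRing.maximalIdeal.isMaximal R).ne_top (top_le_iff.1 (htop ▸ hle))
  refine (CharP.charP_iff_prime_eq_zero Fact.out).2 ?_
  rw [← map_natCast (Ideal.Quotient.mk (Ideal.span {(p : R)})) p, Ideal.Quotient.eq_zero_iff_mem]
  exact Ideal.mem_span_singleton_self _

/-- The reduction modulo `p` of the `i`-th layer of the tower of finite colimits. -/
def phiReductionEquiv (i : ℕ) : R ⧸ Ideal.span {(p : R)} ≃+*
    ((phiTower φ V).reduction (Ideal.span {(p : V)})).obj i :=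
  Ideal.quotientEquiv _ ((phiTower φ V).toRingTower.levelIdeal
    ((phiTower φ V).baseIdeal (Ideal.span {(p : V)})) i) (phiTowerEquiv V φ i) (by
      rw [levelIdeal_eq_span _ (map_span_p p _)]
      exact (map_span_p p (phiTowerEquiv V φ i).toRingHom).symm)

theorem reduction_map_phiReductionEquiv
    {ψ : R ⧸ Ideal.span {(p : R)} →+* R ⧸ Ideal.span {(p : R)}}
    (hψ : ∀ b, ψ (Ideal.Quotient.mk _ b) = Ideal.Quotient.mk _ (φ b)) (i : ℕ)
    (x : R ⧸ Ideal.span {(p : R)}) :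
    ((phiTower φ V).reduction (Ideal.span {(p : V)})).map i (phiReductionEquiv p V φ i x) =
      phiReductionEquiv p V φ (i + 1) (ψ x) := by
  obtain ⟨x, rfl⟩ := Ideal.Quotient.mk_surjective x
  rw [hψ]
  exact congrArg (Ideal.Quotient.mk _) (phiTower_map_phiTowerEquiv V φ i x)

end Towers

/-! ### The tilt of the tower `Vᵢ` as a tower of algebras -/

section RootTilt

variable {p : ℕ} [Fact p.Prime] {V : Type*} [CommRing V]
  [CharP (V ⧸ Ideal.span {(p : V)}) p] [PerfectRing (V ⧸ Ideal.span {(p : V)}) p]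

/-- The power series presentation of the reductions of the tower `Vᵢ`. -/
def rootTowerPowerSeries : PowerSeriesPresentation p (rootTower V p).toRingTower
    ((rootTower V p).baseIdeal (Ideal.span {(p : V)})) (RingHom.id (V ⧸ Ideal.span {(p : V)})) :=
  (rootTowerPresentation p V).toPowerSeries (map_span_p p _) (fun _ => rfl)

/-- Together with `frobeniusEquiv_symm_pow_apply`, this makes the identification of the small tilts
with `k⟦X⟧` linear over `k`: the twist `σ⁻ʲ` matches the `p ^ j`-th roots in `tiltStructure`. -/
theorem rootTowerPowerSeries_toRed_C (i : ℕ) (c : V ⧸ Ideal.span {(p : V)}) :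
    rootTowerPowerSeries.toRed i (PowerSeries.C c) =
      (rootTower V p).redStructure (Ideal.span {(p : V)}) i c := by
  obtain ⟨v, rfl⟩ := Ideal.Quotient.mk_surjective c
  exact (rootTowerPresentation p V).toRed_eq_mk
    (I := (rootTower V p).baseIdeal (Ideal.span {(p : V)})) (ψ' := RingHom.id _)
    (map_span_p p _) (fun _ => rfl) i _ _ (adjoinPRootReduction_of i v)

theorem frobeniusEquiv_symm_pow_apply {K : Type*} [CommRing K] [CharP K p] [PerfectRing K p]
    (j : ℕ) (c : K) :
    (((frobeniusEquiv K p).symm : K →+* K) ^ j) c = (iterateFrobeniusEquiv K p j).symm c := by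
  induction j generalizing c with
  | zero =>
    rw [RingEquiv.eq_symm_apply]
    simp
  | succ j ih =>
    rw [pow_succ, RingHom.mul_def, RingHom.comp_apply, ih, RingEquiv.eq_symm_apply,
      iterateFrobeniusEquiv_apply, iterateFrobenius_def, pow_succ, pow_mul,
      ← iterateFrobenius_def, ← iterateFrobeniusEquiv_apply, RingEquiv.apply_symm_apply]
    exact (frobeniusEquiv K p).apply_symm_apply c

variable (h : IsPurelyInseparable p (rootTower V p).toRingTower
  ((rootTower V p).baseIdeal (Ideal.span {(p : V)})))

/-- The small tilts of the tower `Vᵢ` are power series rings over `V / p`. -/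
def rootTiltEquiv (i : ℕ) :
    (V ⧸ Ideal.span {(p : V)})⟦X⟧ ≃ₐ[V ⧸ Ideal.span {(p : V)}] (AlgTower.tilt h).obj i :=
  AlgEquiv.ofRingEquiv (f := rootTowerPowerSeries.tiltEquiv
    (σ := frobeniusEquiv (V ⧸ Ideal.span {(p : V)}) p) (fun _ => rfl) h i) (by
    intro c
    refine Subtype.ext (funext fun j => ?_)
    refine (rootTowerPowerSeries.toTilt_apply
      (σ := frobeniusEquiv (V ⧸ Ideal.span {(p : V)}) p) (fun _ => rfl) h i j _).trans ?_
    rw [PowerSeries.algebraMap_apply, PowerSeries.map_C, rootTowerPowerSeries_toRed_C]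
    exact congrArg _ (frobeniusEquiv_symm_pow_apply j c))

theorem tilt_map_rootTiltEquiv (i : ℕ) (f : (V ⧸ Ideal.span {(p : V)})⟦X⟧) :
    (AlgTower.tilt h).map i (rootTiltEquiv h i f) =
      rootTiltEquiv h (i + 1) (expand p (Fact.out : p.Prime).ne_zero f) := by
  have := rootTowerPowerSeries.tiltMap_toTilt
    (σ := frobeniusEquiv (V ⧸ Ideal.span {(p : V)}) p) (fun _ => rfl) (fun _ _ h => h) h i f
  rw [PowerSeries.map_id] at this
  exact this

theorem ker_projZero_eq_span_rootTiltEquiv (i : ℕ) :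
    (RingHom.ker (h.projZero i) : Ideal ((AlgTower.tilt h).obj i)) =
      Ideal.span {rootTiltEquiv h i (X ^ p ^ i)} :=
  rootTowerPowerSeries.ker_projZero (σ := frobeniusEquiv (V ⧸ Ideal.span {(p : V)}) p)
    (fun _ => rfl) h i

end RootTilt

/-! ### The main theorem -/

/-- The isomorphism of power series rings induced by an isomorphism of coefficient rings. -/
def powerSeriesMapEquiv {K L : Type*} [CommRing K] [CommRing L] (e : K ≃+* L) : K⟦X⟧ ≃+* L⟦X⟧ :=
  RingEquiv.ofRingHom (PowerSeries.map (e : K →+* L)) (PowerSeries.map (e.symm : L →+* K))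
    (by ext; simp) (by ext; simp)

theorem IsPhiStable.quotientMap_sub_pow_mem {p : ℕ} [Fact p.Prime] {A : Type*} [CommRing A]
    {δ : PDerivation p A} {I : Ideal A} (hI : IsPhiStable δ.phi I) (x : A ⧸ I) :
    hI.quotientMap x - x ^ p ∈ Ideal.span {(p : A ⧸ I)} := by
  obtain ⟨a, rfl⟩ := Ideal.Quotient.mk_surjective x
  refine Ideal.mem_span_singleton.2 ⟨Ideal.Quotient.mk I (δ.toFun a), ?_⟩
  change Ideal.Quotient.mk I (a ^ p + p * δ.toFun a) - _ = _
  rw [map_add, map_mul, map_pow, map_natCast, add_sub_cancel_left]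

/-! ### Comparison of the tilt with the completed tensor product. -/

section Isomorphism

variable {p : ℕ} [Fact p.Prime] {V : Type*} [CommRing V]
  [CharP (V ⧸ Ideal.span {(p : V)}) p] [PerfectRing (V ⧸ Ideal.span {(p : V)}) p]
  {R : Type*} [CommRing R] [Algebra V R] {φ : R →+* R}
  [CharP (R ⧸ Ideal.span {(p : R)}) p]

/-- Both towers are carried to `(R/p)⟦X⟧`. In the completed tensor product the Frobenius on
coefficients comes from the reduction of `τ_i`, seen on last copies of `R`, and `X ↦ X ^ p` comes
from the tilt of `V_i`. -/
theorem tilt_sTower_isIsomorphic (hred : IsReduced (R ⧸ Ideal.span {(p : R)}))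
    (hφ : ∀ x, φ x - x ^ p ∈ Ideal.span {(p : R)})
    (h : IsPurelyInseparable p (rootTower V p).toRingTower
      ((rootTower V p).baseIdeal (Ideal.span {(p : V)})))
    {I : Ideal ((sTower V p φ).toRingTower.obj 0)}
    (hI : I = Ideal.span {(p : (sTower V p φ).toRingTower.obj 0)})
    (hS : IsPurelyInseparable p (sTower V p φ).toRingTower I) :
    hS.tilt.IsIsomorphic
      (((phiTower φ V).reduction (Ideal.span {(p : V)})).completedTensor (AlgTower.tilt h)
        (fun i => RingHom.ker (h.projZero i)) h.map_ker_projZero_le) := by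
  have hψ : ∀ b, frobenius (R ⧸ Ideal.span {(p : R)}) p (Ideal.Quotient.mk _ b) =
      Ideal.Quotient.mk _ (φ b) := fun b =>
    ((Ideal.Quotient.eq.2 (hφ b)).trans (map_pow _ _ _)).symm
  let E := (sTowerPresentation p V φ).toPowerSeries hI hψ
  have hp0 : ∀ i, 0 < p ^ i := fun i => pow_pos (Fact.out : p.Prime).pos i
  -- Here `ψ` is already the Frobenius, so `σ` is the identity and no perfectness of `R/p` is
  -- needed.
  have hσ : ∀ x, frobenius (R ⧸ Ideal.span {(p : R)}) p (RingEquiv.refl _ x) = x ^ p :=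
    fun x => rfl
  have hinj : Function.Injective (frobenius (R ⧸ Ideal.span {(p : R)}) p) :=
    frobenius_inj _ p
  let c : ∀ i, (R ⧸ Ideal.span {(p : R)})⟦X⟧ ≃+* _ := fun i =>
    (powerSeriesMapEquiv (phiReductionEquiv p V φ i)).trans
      (completionEquiv (((phiTower φ V).reduction (Ideal.span {(p : V)})).obj i)
        (rootTiltEquiv h i) (ker_projZero_eq_span_rootTiltEquiv h i) (hp0 i))
  refine ⟨fun i => (E.tiltEquiv hσ hS i).symm.trans (c i), fun i x => ?_⟩
  obtain ⟨f, rfl⟩ := (E.tiltEquiv hσ hS i).surjective x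
  have h1 : hS.tilt.map i (E.tiltEquiv hσ hS i f) = E.tiltEquiv hσ hS (i + 1) _ :=
    E.tiltMap_toTilt hσ hinj hS i f
  rw [h1]
  have h2 : ∀ j g, (E.tiltEquiv hσ hS j).symm.trans (c j) (E.tiltEquiv hσ hS j g) = c j g :=
    fun j g => congrArg (c j) ((E.tiltEquiv hσ hS j).symm_apply_apply g)
  refine (h2 _ _).trans (Eq.trans ?_ (congrArg _ (h2 i f)).symm)
  -- The exponents are `N = p ^ i` and `N' = p ^ (i + 1)`, so the bound `N' ≤ p * N` is an equality.
  refine Eq.trans ?_ (adicCompletionMap_powerSeriesToCompletion (rootTiltEquiv h i)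
    (ker_projZero_eq_span_rootTiltEquiv h i) (rootTiltEquiv h (i + 1))
    (ker_projZero_eq_span_rootTiltEquiv h (i + 1)) (Fact.out : p.Prime).ne_zero
    (((phiTower φ V).reduction (Ideal.span {(p : V)})).map i) ((AlgTower.tilt h).map i)
    (tilt_map_rootTiltEquiv h i) (pow_succ' p i).le
    (map_tensorIdeal_le _ _ (h.map_ker_projZero_le i)) _).symm
  refine congrArg (powerSeriesToCompletion
    (((phiTower φ V).reduction (Ideal.span {(p : V)})).obj (i + 1)) (rootTiltEquiv h (i + 1))
    (ker_projZero_eq_span_rootTiltEquiv h (i + 1))) ?_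
  change PowerSeries.map (phiReductionEquiv p V φ (i + 1)).toRingHom (expand p _
      (PowerSeries.map (frobenius (R ⧸ Ideal.span {(p : R)}) p) f)) =
    expand p _ (PowerSeries.map (((phiTower φ V).reduction (Ideal.span {(p : V)})).map i).toRingHom
      (PowerSeries.map (phiReductionEquiv p V φ i).toRingHom f))
  rw [PowerSeries.map_expand]
  congr 1
  ext d
  simp only [PowerSeries.coeff_map]
  exact (reduction_map_phiReductionEquiv p V φ hψ i _).symm

end Isomorphism

end PerfdTower

end

theorem mainTheorem2
    (p : ℕ) [Fact p.Prime]
    -- a complete unramified discrete valuation ring of mixed characteristic, perfect residue field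
    {V : Type*} [CommRing V] [IsDomain V] [IsDiscreteValuationRing V] [CharZero V]
    (hVp : IsLocalRing.maximalIdeal V = Ideal.span {(p : V)})
    [IsAdicComplete (IsLocalRing.maximalIdeal V) V]
    [CharP (V ⧸ Ideal.span {(p : V)}) p] [PerfectRing (V ⧸ Ideal.span {(p : V)}) p]
    -- a `δ`-ring `A` and a `φ`-stable ideal `I`
    {A : Type*} [CommRing A] (δ : PDerivation p A) (I : Ideal A) (hI : IsPhiStable δ.phi I)
    -- `A ⧸ I` is a Noetherian local `V`-algebra with the same residue field
    [IsLocalRing (A ⧸ I)] [IsNoetherianRing (A ⧸ I)] [Algebra V (A ⧸ I)]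
    [IsLocalHom (algebraMap V (A ⧸ I))]
    (hres : Function.Bijective (IsLocalRing.ResidueField.map (algebraMap V (A ⧸ I))))
    -- `A ⧸ I` is `p`-torsion free, and its reduction modulo `p` is reduced
    (htf : ∀ x : A ⧸ I, (p : A ⧸ I) * x = 0 → x = 0)
    (hred : IsReduced ((A ⧸ I) ⧸ Ideal.span {(p : A ⧸ I)})) :
    ∃ (hV : IsPerfectoidTowerFrom p (rootTower V p).toRingTower
          (algebraMap V ((rootTower V p).obj 0)) (Ideal.span {(p : V)}))
      (hS : IsPerfectoidTowerFrom p (sTower V p hI.quotientMap).toRingTower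
          (toSTowerZero V p hI.quotientMap) (Ideal.span {(p : A ⧸ I)})),
      hS.tilt.IsIsomorphic
        (((phiTower hI.quotientMap V).reduction (Ideal.span {(p : V)})).completedTensor
          (AlgTower.tilt hV.isPurelyInseparable)
          (fun i => RingHom.ker (hV.isPurelyInseparable.projZero i))
          hV.isPurelyInseparable.map_ker_projZero_le) := by
  have hpV : (p : V) ∈ IsLocalRing.maximalIdeal V := hVp ▸ Ideal.mem_span_singleton_self _
  -- A local map reflects units, so `p` stays a nonunit in `R`.
  have hpR : (p : A ⧸ I) ∈ IsLocalRing.maximalIdeal (A ⧸ I) := by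
    rw [IsLocalRing.mem_maximalIdeal, mem_nonunits_iff] at hpV ⊢
    exact fun hu => hpV (isUnit_of_map_unit (algebraMap V (A ⧸ I)) _ (by rwa [map_natCast]))
  have hchar := charP_quotient_span p hpR
  have hφ := hI.quotientMap_sub_pow_mem
  have hp0 : (p : V) ≠ 0 := Nat.cast_ne_zero.2 (Fact.out : p.Prime).ne_zero
  have hV : IsPerfectoidTowerFrom p (rootTower V p).toRingTower
      (algebraMap V ((rootTower V p).obj 0)) (Ideal.span {(p : V)}) :=
    -- For `V` the coefficients are fixed, and perfectness makes Frobenius available as the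
    -- automorphism `σ`.
    ⟨algebraMap_rootTower_bijective p V,
      (rootTowerPresentation p V).isPerfectoidTower (map_span_p p _) (ψ' := RingHom.id _)
        (σ := frobeniusEquiv _ p) (fun _ => rfl) (fun _ _ h => h) (fun _ => rfl)
        (fun b hb => (mul_eq_zero.1 hb).resolve_left hp0)
        (by rwa [IsLocalRing.ringJacobson_eq_maximalIdeal])⟩
  have hS : IsPerfectoidTowerFrom p (sTower V p hI.quotientMap).toRingTower
      (toSTowerZero V p hI.quotientMap) (Ideal.span {(p : A ⧸ I)}) :=
    -- For `R` the roles are exchanged: `ψ` is the Frobenius, injective because `R/p` is reduced.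
    ⟨toSTowerZero_bijective p V hI.quotientMap,
      (sTowerPresentation p V hI.quotientMap).isPerfectoidTower (map_span_p p _)
        (ψ' := frobenius _ p) (σ := RingEquiv.refl _)
        (fun b => ((Ideal.Quotient.eq.2 (hφ b)).trans (map_pow _ _ _)).symm)
        (frobenius_inj _ p) (fun _ => rfl) htf
        (by rwa [IsLocalRing.ringJacobson_eq_maximalIdeal])⟩
  exact ⟨hV, hS, tilt_sTower_isIsomorphic hred hφ hV.isPurelyInseparable (map_span_p p _)
    hS.isPurelyInseparable⟩
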